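/- Let $\mathsf{k}$ and $\mathsf{h}$ be complex Hilbert spaces and let $\mathcal{F}$, $\mathcal{F}_{t)}$ and $\mathcal{F}_{[t}$ be the Boson Fock spaces over $L^2(\mathbb{R}_+;\mathsf{k})$, $L^2([0,t);\mathsf{k})$ and $L^2([t,\infty);\mathsf{k})$ respectively, with exponential vectors $\varepsilon(f)$, so that $\langle\varepsilon(f),\varepsilon(g)\rangle=\exp\langle f,g\rangle$ and $\mathcal{F}\cong\mathcal{F}_{t)}\otimes\mathcal{F}_{[t}$ via $\varepsilon(f)\leftrightarrow\varepsilon(f|_{[0,t)})\otimes\varepsilon(f|_{[t,\infty)})$. For $t\in[0,\infty)$ let $E_t$ be the orthogonal projection on $\mathcal{F}$ with $E_t\varepsilon(f)=\varepsilon(1_{[0,t)}f)$, and let $E_\infty=I$. Let $\Gamma_t:\mathcal{F}\to\mathcal{F}_{[t}$ be the unitary operator $\varepsilon(f)\mapsto\varepsilon(f(\cdot-t))$. The CCR flow is $\sigma_t(X)=I_{t)}\otimes\Gamma_tX\Gamma_t^*$, extended by ampliation to $B(\mathsf{h}\otimes\mathcal{F})$. A finite quantum stop time is a spectral measure $S$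 on the Borel subsets of $[0,\infty]$, with values orthogonal projections on $\mathcal{F}$, such that $S([0,t])\in B(\mathcal{F}_{t)})\otimes I_{[t}$ for all $t\in(0,\infty)$, $S(\{0\})=0$ and $S(\{\infty\})=0$. Let $\mathcal{A}\subseteq B(\mathsf{h})$ be a von Neumann algebra and let $p$ be an orthogonal projection on $\mathsf{k}$; let $P_{[t}$ be the operator on $\mathcal{F}_{[t}$ with $P_{[t}\varepsilon(f)=\varepsilon(pf)$, where $p$ acts pointwise. An isometric $p$-adapted cocycle is a family $V=(V_t)_{t\ge0}$ in $\mathcal{A}\,\overline{\otimes}\,B(\mathcal{F})$ such that, for all $s,t\ge 0$, $V_t=V_{t)}\otimes P_{[t}$, where $V_{t)}\in\mathcal{A}\,\overline{\otimes}\,B(\mathcal{F}_{t)})$ is an isometry, and $V_{s+t}=(V_{s)}\otimes I_{[s})\,\sigma_s(V_t)$. It is vacuum adapted if $p=0$, and identity adapted if $p=I$. Let $S$ be a finite quantum stop time, let $V$ be an isometric $p$-adapted cocycle such that $t\mapsto V_tz$ is continuous on $[0,\infty)$ for each $z\in\mathsf{h}\otimes\mathcal{F}$, and let $S$ also denote its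 ampliation to $\mathsf{h}\otimes\mathcal{F}$. For $t\in(0,\infty)$ let $$V_{S,t}=\operatorname*{st.lim}_\pi\sum_{j=1}^{n+1}V_{\pi_j}S\bigl((\pi_{j-1},\pi_j]\bigr),$$ the strong limit over finite partitions $\pi=\{0=\pi_0<\dots<\pi_{n+1}=t\}$ ordered by refinement, and let $V_S=V_{S,\infty}=\operatorname{st.lim}_{t\to\infty}V_{S,t}$. For $t\in(0,\infty]$ let $$E_{S,t}=\operatorname*{st.lim}_\pi\sum_{j=1}^{n+1}S\bigl((\pi_{j-1},\pi_j]\bigr)E_{\pi_j},$$ where $\pi$ runs over the finite partitions of $[0,t]$, also extended by ampliation to $\mathsf{h}\otimes\mathcal{F}$. (a) If $V$ is vacuum adapted then the limits defining $V_{S,t}$ and $E_{S,t}$ exist for all $t\in(0,\infty]$, and $$V_{S,t}E_{S,t}=V_{S,t}\qquad\text{and}\qquad\|V_{S,t}z\|=\|E_{S,t}z\|\qquad\text{for all }z\in\mathsf{h}\otimes\mathcal{F}.$$ (b) If $V$ is identity adapted then the limits defining $V_{S,t}$ exist for all $t\in(0,\infty]$, and $$\|V_{S,t}z\|=\|S([0,t])z\|\qquad\text{for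 all }z\in\mathsf{h}\otimes\mathcal{F};$$ in particular, $V_S$ is an isometry. -/

import Mathlib

open MeasureTheory Filter Topology
open scoped NNReal ENNReal InnerProductSpace TensorProduct

noncomputable section

namespace StopCCR

section Fock

variable {H : Type*} [NormedAddCommGroup H] [InnerProductSpace ℂ H]

open scoped ComplexOrder in
theorem powKernel_posSemidef {ι : Type*} [Fintype ι] (v : ι → H) (n : ℕ) :
    (Matrix.of fun i j : ι => (⟪v i, v j⟫_ℂ) ^ n).PosSemidef := by
  induction n with
  | zero =>
    have h : (Matrix.of fun i j : ι => (⟪v i, v j⟫_ℂ) ^ 0) =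
        Matrix.gram ℂ (fun _ : ι => (1 : ℂ)) := by
      ext i j
      simp [Matrix.gram]
    rw [h]
    exact Matrix.posSemidef_gram ℂ _
  | succ n ih =>
    have h : (Matrix.of fun i j : ι => (⟪v i, v j⟫_ℂ) ^ (n + 1)) =
        (Matrix.of fun i j : ι => (⟪v i, v j⟫_ℂ) ^ n).hadamard (Matrix.gram ℂ v) := by
      ext i j
      simp [Matrix.gram, pow_succ]
    rw [h]
    exact ih.hadamard (Matrix.posSemidef_gram ℂ v)

/-- The sesquilinear form with `⟪ε f, ε g⟫ = exp ⟪f, g⟫` on formal finite linear combinations of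
exponential vectors. -/
def expForm (c d : H →₀ ℂ) : ℂ :=
  c.sum fun f a => d.sum fun g b => (starRingEnd ℂ a) * b * Complex.exp ⟪f, g⟫_ℂ

open scoped ComplexOrder in
theorem expForm_self_nonneg (c : H →₀ ℂ) : 0 ≤ (expForm c c).re := by
  have hterm : ∀ n : ℕ, 0 ≤ (∑ f ∈ c.support, ∑ g ∈ c.support,
      (starRingEnd ℂ (c f)) * c g * ((⟪f, g⟫_ℂ) ^ n / (n.factorial : ℂ))).re := by
    intro n
    have h := (powKernel_posSemidef (fun f : c.support => (f : H)) n).dotProduct_mulVec_nonneg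
      (fun f : c.support => c f)
    have h2 : (star (fun f : c.support => c f)) ⬝ᵥ
        ((Matrix.of fun i j : c.support => (⟪(i : H), (j : H)⟫_ℂ) ^ n).mulVec
          (fun f : c.support => c f)) =
        ∑ f ∈ c.support, ∑ g ∈ c.support,
          (starRingEnd ℂ (c f)) * c g * (⟪f, g⟫_ℂ) ^ n := by
      simp only [dotProduct, Matrix.mulVec, Matrix.of_apply, Pi.star_apply, Finset.mul_sum]
      rw [← Finset.sum_coe_sort c.support]
      refine Finset.sum_congr rfl fun f _ => ?_
      rw [← Finset.sum_coe_sort c.support]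
      refine Finset.sum_congr rfl fun g _ => ?_
      simp only [RCLike.star_def]
      ring
    rw [h2] at h
    have h3 := (Complex.le_def.1 h).1
    have h4 : (∑ f ∈ c.support, ∑ g ∈ c.support,
        (starRingEnd ℂ (c f)) * c g * ((⟪f, g⟫_ℂ) ^ n / (n.factorial : ℂ))) =
        (∑ f ∈ c.support, ∑ g ∈ c.support,
          (starRingEnd ℂ (c f)) * c g * (⟪f, g⟫_ℂ) ^ n) * (((n.factorial : ℝ)⁻¹ : ℝ) : ℂ) := by
      simp only [Finset.sum_mul]
      refine Finset.sum_congr rfl fun f _ => Finset.sum_congr rfl fun g _ => ?_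
      push_cast
      ring
    rw [h4, Complex.re_mul_ofReal]
    exact mul_nonneg (by simpa using h3) (by positivity)
  have hsum : HasSum (fun n : ℕ => ∑ f ∈ c.support, ∑ g ∈ c.support,
      (starRingEnd ℂ (c f)) * c g * ((⟪f, g⟫_ℂ) ^ n / (n.factorial : ℂ)))
      (∑ f ∈ c.support, ∑ g ∈ c.support,
        (starRingEnd ℂ (c f)) * c g * Complex.exp ⟪f, g⟫_ℂ) := by
    refine hasSum_sum fun f _ => hasSum_sum fun g _ => HasSum.mul_left _ ?_
    rw [Complex.exp_eq_exp_ℂ]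
    exact NormedSpace.expSeries_div_hasSum_exp _
  exact (Complex.hasSum_re hsum).nonneg hterm

theorem expForm_conj (c d : H →₀ ℂ) : starRingEnd ℂ (expForm d c) = expForm c d := by
  rw [expForm, expForm, Finsupp.sum_comm]
  simp only [map_finsuppSum]
  congr! 4
  simp [← Complex.exp_conj, mul_comm]

theorem expForm_add_left (c d e : H →₀ ℂ) :
    expForm (c + d) e = expForm c e + expForm d e := by
  refine Finsupp.sum_add_index' (fun f => ?_) (fun f a b => ?_)
  · simp
  · simp [← Finsupp.sum_add, add_mul]

theorem expForm_smul_left (c d : H →₀ ℂ) (r : ℂ) :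
    expForm (r • c) d = starRingEnd ℂ r * expForm c d := by
  refine (Finsupp.sum_smul_index (fun f => ?_)).trans ?_
  · simp
  · simp [expForm, Finsupp.mul_sum, mul_assoc]

/-- Formal finite linear combinations of exponential vectors. -/
def FockPre (H : Type*) : Type _ := H →₀ ℂ

instance : AddCommGroup (FockPre H) := inferInstanceAs (AddCommGroup (H →₀ ℂ))
instance : Module ℂ (FockPre H) := inferInstanceAs (Module ℂ (H →₀ ℂ))

/-- The formal exponential vector of `f`. -/
def preExp (f : H) : FockPre H := Finsupp.single f (1 : ℂ)

theorem mem_span_preExp {K : Type*} (c : FockPre K) :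
    c ∈ Submodule.span ℂ (Set.range (preExp (H := K))) := by
  change (c : K →₀ ℂ) ∈ Submodule.span ℂ (Set.range fun f : K => Finsupp.single f (1 : ℂ))
  rw [← Set.image_univ, ← Finsupp.supported_eq_span_single, Finsupp.supported_univ]
  trivial

instance fockPreCore : PreInnerProductSpace.Core ℂ (FockPre H) where
  inner c d := expForm c d
  conj_inner_symm c d := expForm_conj c d
  add_left c d e := expForm_add_left c d e
  smul_left c d r := expForm_smul_left c d r
  re_inner_nonneg c := expForm_self_nonneg c

instance : SeminormedAddCommGroup (FockPre H) :=
  InnerProductSpace.Core.toSeminormedAddCommGroup (𝕜 := ℂ)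

instance : InnerProductSpace ℂ (FockPre H) := .ofCore _

variable (H) in
/-- The Boson Fock space over `H`: the Hilbert space generated by the exponential vectors `ε f`,
`f ∈ H`, with `⟪ε f, ε g⟫ = exp ⟪f, g⟫`. -/
abbrev Fock : Type _ := UniformSpace.Completion (FockPre H)

/-- The exponential vector of `f`. -/
def expVec (f : H) : Fock H := (preExp f : Fock H)

theorem inner_expVec (f g : H) : ⟪expVec f, expVec g⟫_ℂ = Complex.exp ⟪f, g⟫_ℂ := by
  rw [expVec, expVec, UniformSpace.Completion.inner_coe]
  change expForm (Finsupp.single f (1 : ℂ)) (Finsupp.single g (1 : ℂ)) = _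
  simp [expForm]

theorem span_expVec_dense :
    Dense (Submodule.span ℂ (Set.range (expVec : H → Fock H)) : Set (Fock H)) := by
  refine Dense.mono ?_ (UniformSpace.Completion.denseRange_coe (α := FockPre H))
  rintro _ ⟨c, rfl⟩
  change (UniformSpace.Completion.toComplₗᵢ (𝕜 := ℂ) c) ∈ _
  have hle : Submodule.span ℂ (Set.range (preExp (H := H))) ≤
      (Submodule.span ℂ (Set.range (expVec : H → Fock H))).comap
        (UniformSpace.Completion.toComplₗᵢ (𝕜 := ℂ) (E := FockPre H)).toLinearMap := by
    rw [Submodule.span_le]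
    rintro _ ⟨f, rfl⟩
    exact Submodule.subset_span ⟨f, rfl⟩
  exact hle (mem_span_preExp c)

end Fock

section Isometry

variable {E G : Type*} [NormedAddCommGroup E] [InnerProductSpace ℂ E]
  [NormedAddCommGroup G] [InnerProductSpace ℂ G] {ι : Type*}

/-- A map between families of vectors which preserves inner products extends to an isometry. -/
theorem exists_isometry [CompleteSpace G] (a : ι → E) (b : ι → G)
    (hab : ∀ i j, ⟪a i, a j⟫_ℂ = ⟪b i, b j⟫_ℂ)
    (ha : Dense (Submodule.span ℂ (Set.range a) : Set E)) :
    ∃ U : E →ₗᵢ[ℂ] G, ∀ i, U (a i) = b i := by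
  let La := Finsupp.linearCombination ℂ a
  let Lb := Finsupp.linearCombination ℂ b
  have hin : ∀ c d, ⟪La c, La d⟫_ℂ = ⟪Lb c, Lb d⟫_ℂ := by
    intro c d
    simp only [La, Lb, Finsupp.linearCombination_apply, Finsupp.sum_inner, Finsupp.inner_sum,
      inner_smul_left, inner_smul_right, hab]
  have hnorm : ∀ c, ‖Lb c‖ = ‖La c‖ := fun c => by
    rw [@norm_eq_sqrt_re_inner ℂ, @norm_eq_sqrt_re_inner ℂ, hin]
  have hker : LinearMap.ker La.rangeRestrict ≤ LinearMap.ker Lb := by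
    intro c hc
    have h0 : La c = 0 := by simpa using hc
    rw [LinearMap.mem_ker, ← norm_eq_zero, hnorm, h0, norm_zero]
  let T : LinearMap.range La →ₗ[ℂ] G := ((LinearMap.ker La.rangeRestrict).liftQ Lb hker) ∘ₗ
    (La.rangeRestrict.quotKerEquivOfSurjective La.surjective_rangeRestrict).symm.toLinearMap
  have hT : ∀ c, T (La.rangeRestrict c) = Lb c := by
    intro c
    have : (La.rangeRestrict.quotKerEquivOfSurjective La.surjective_rangeRestrict).symm
        (La.rangeRestrict c) = Submodule.Quotient.mk c := by
      rw [LinearEquiv.symm_apply_eq]; rfl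
    simp only [T, LinearMap.comp_apply, LinearEquiv.coe_coe, this]
    rfl
  have hTn : ∀ x, ‖T x‖ = ‖x‖ := by
    intro x
    obtain ⟨c, rfl⟩ := La.surjective_rangeRestrict x
    rw [hT, hnorm]; rfl
  let Ti : LinearMap.range La →ₗᵢ[ℂ] G := ⟨T, hTn⟩
  let e := (LinearMap.range La).subtypeL
  have hd : DenseRange e := by
    have : Set.range e = (Submodule.span ℂ (Set.range a) : Set E) := by
      rw [← Finsupp.range_linearCombination]
      ext x
      simp [e, La]
    rw [DenseRange, this]; exact ha
  have hu : IsUniformInducing e := isUniformEmbedding_subtype_val.isUniformInducing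
  let U := Ti.toContinuousLinearMap.extend e
  have hU : ∀ x, U (e x) = Ti x := fun x =>
    ContinuousLinearMap.extend_eq Ti.toContinuousLinearMap hd hu x
  have hUn : ∀ x, ‖U x‖ = ‖x‖ := by
    intro x
    refine hd.induction_on (p := fun x => ‖U x‖ = ‖x‖) x
      (isClosed_eq (by fun_prop) (by fun_prop)) fun y => ?_
    rw [hU, Ti.norm_map]; rfl
  refine ⟨⟨U.toLinearMap, hUn⟩, fun i => ?_⟩
  have h1 : a i = e (La.rangeRestrict (Finsupp.single i 1)) := by simp [e, La]
  change U (a i) = b i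
  rw [h1, hU]
  change T _ = _
  rw [hT]
  simp [Lb]

/-- If both families are total then the isometry is unitary. -/
theorem exists_unitary [CompleteSpace E] [CompleteSpace G] (a : ι → E) (b : ι → G)
    (hab : ∀ i j, ⟪a i, a j⟫_ℂ = ⟪b i, b j⟫_ℂ)
    (ha : Dense (Submodule.span ℂ (Set.range a) : Set E))
    (hb : Dense (Submodule.span ℂ (Set.range b) : Set G)) :
    ∃ U : E ≃ₗᵢ[ℂ] G, ∀ i, U (a i) = b i := by
  obtain ⟨U, hU⟩ := exists_isometry a b hab ha
  have hsurj : Function.Surjective U := by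
    have hc : IsClosed (Set.range U) := U.isometry.isClosedEmbedding.isClosed_range
    have hsub : (Submodule.span ℂ (Set.range b) : Set G) ⊆ Set.range U := by
      have : Submodule.span ℂ (Set.range b) ≤ LinearMap.range U.toLinearMap := by
        rw [Submodule.span_le]
        rintro _ ⟨i, rfl⟩
        exact ⟨a i, hU i⟩
      intro x hx
      exact this hx
    rw [← Set.range_eq_univ, ← hc.closure_eq]
    exact (hb.mono hsub).closure_eq
  exact ⟨LinearIsometryEquiv.ofSurjective U hsurj, hU⟩

end Isometry

section Tensor

variable (E G : Type*) [NormedAddCommGroup E] [InnerProductSpace ℂ E]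
  [NormedAddCommGroup G] [InnerProductSpace ℂ G]

/-- The Hilbert-space tensor product. -/
abbrev HTensor : Type _ := UniformSpace.Completion (E ⊗[ℂ] G)

variable {E G}

/-- The elementary tensor `x ⊗ y`. -/
def htmul (x : E) (y : G) : HTensor E G := ((x ⊗ₜ[ℂ] y : E ⊗[ℂ] G) : HTensor E G)

theorem inner_htmul (x x' : E) (y y' : G) :
    ⟪htmul x y, htmul x' y'⟫_ℂ = ⟪x, x'⟫_ℂ * ⟪y, y'⟫_ℂ := by
  rw [htmul, htmul, UniformSpace.Completion.inner_coe, TensorProduct.inner_tmul]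

variable {E' G' : Type*} [NormedAddCommGroup E'] [InnerProductSpace ℂ E']
  [NormedAddCommGroup G'] [InnerProductSpace ℂ G']

/-- The tensor product `A ⊗ B` of bounded operators. -/
def opTensor (A : E →L[ℂ] E') (B : G →L[ℂ] G') : HTensor E G →L[ℂ] HTensor E' G' :=
  (TensorProduct.mapL A B).completion

theorem opTensor_htmul (A : E →L[ℂ] E') (B : G →L[ℂ] G') (x : E) (y : G) :
    opTensor A B (htmul x y) = htmul (A x) (B y) := by
  simp only [opTensor, htmul]
  rw [ContinuousLinearMap.completion_apply_coe]
  rfl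

theorem span_htmul_dense {ι κ : Type*} (a : ι → E) (b : κ → G)
    (ha : Dense (Submodule.span ℂ (Set.range a) : Set E))
    (hb : Dense (Submodule.span ℂ (Set.range b) : Set G)) :
    Dense (Submodule.span ℂ (Set.range fun i : ι × κ => htmul (a i.1) (b i.2)) :
      Set (HTensor E G)) := by
  set P := (Submodule.span ℂ (Set.range fun i : ι × κ => htmul (a i.1) (b i.2))).topologicalClosure
    with hP
  let m : E →L[ℂ] G →L[ℂ] HTensor E G :=
    (ContinuousLinearMap.compL ℂ G (E ⊗[ℂ] G) (HTensor E G)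
      (UniformSpace.Completion.toComplL (𝕜 := ℂ))).comp (TensorProduct.mkL ℂ E G)
  have hm : ∀ x y, m x y = htmul x y := fun x y => rfl
  have hPc : IsClosed (P : Set (HTensor E G)) := Submodule.isClosed_topologicalClosure _
  have h1 : ∀ i y, htmul (a i) y ∈ P := by
    intro i y
    have hle : Submodule.span ℂ (Set.range b) ≤ P.comap (m (a i)).toLinearMap := by
      rw [Submodule.span_le]
      rintro _ ⟨k, rfl⟩
      exact Submodule.le_topologicalClosure _ (Submodule.subset_span ⟨(i, k), rfl⟩)
    have hcl : IsClosed {y | m (a i) y ∈ P} := hPc.preimage (m (a i)).continuous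
    have : y ∈ closure (Submodule.span ℂ (Set.range b) : Set G) := hb y
    exact closure_minimal (fun z hz => hle hz) hcl this
  have h2 : ∀ x y, htmul x y ∈ P := by
    intro x y
    have hle : Submodule.span ℂ (Set.range a) ≤ P.comap (m.flip y).toLinearMap := by
      rw [Submodule.span_le]
      rintro _ ⟨k, rfl⟩
      exact h1 k y
    have hcl : IsClosed {x | m.flip y x ∈ P} := hPc.preimage (m.flip y).continuous
    exact closure_minimal (fun z hz => hle hz) hcl (ha x)
  have h3 : ∀ z : E ⊗[ℂ] G, (z : HTensor E G) ∈ P := by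
    intro z
    change (UniformSpace.Completion.toComplₗᵢ (𝕜 := ℂ) z) ∈ P
    induction z with
    | zero => rw [map_zero]; exact P.zero_mem
    | tmul x y => exact h2 x y
    | add x y hx hy => rw [map_add]; exact P.add_mem hx hy
  have h4 : Dense (P : Set (HTensor E G)) := by
    refine Dense.mono ?_ (UniformSpace.Completion.denseRange_coe (α := E ⊗[ℂ] G))
    rintro _ ⟨z, rfl⟩
    exact h3 z
  rw [hP, Submodule.topologicalClosure_coe] at h4
  exact dense_closure.1 h4

/-- The ultraweak tensor product of a von Neumann algebra with the algebra of all bounded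
operators on `G`: the von Neumann algebra (double commutant) generated by the `A ⊗ B`. -/
def vnTensor [CompleteSpace E] (𝒜 : VonNeumannAlgebra E) (G : Type*) [NormedAddCommGroup G]
    [InnerProductSpace ℂ G] : Set (HTensor E G →L[ℂ] HTensor E G) :=
  Set.centralizer (Set.centralizer {T | ∃ A ∈ 𝒜, ∃ B : G →L[ℂ] G, T = opTensor A B})

end Tensor

section Time

/-- Lebesgue measure on the half-line `[0, ∞)`. -/
abbrev halfLine : Measure ℝ := (volume : Measure ℝ).restrict (Set.Ici 0)

variable (k : Type*) [NormedAddCommGroup k] [InnerProductSpace ℂ k]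

/-- `L²(ℝ₊; k)`. -/
abbrev L2 : Type _ := Lp k 2 halfLine

/-- `L²(A; k)` for `A ⊆ ℝ₊`. -/
abbrev L2On (A : Set ℝ) : Type _ := Lp k 2 (halfLine.restrict A)

/-- The Fock space `𝓕` over `L²(ℝ₊; k)`. -/
abbrev FockSpace : Type _ := Fock (L2 k)

/-- The Fock space over `L²([0, t); k)`. -/
abbrev FockPast (t : ℝ≥0) : Type _ := Fock (L2On k (Set.Ico 0 (t : ℝ)))

/-- The Fock space over `L²([t, ∞); k)`. -/
abbrev FockFuture (t : ℝ≥0) : Type _ := Fock (L2On k (Set.Ici (t : ℝ)))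

variable {k}

/-- The restriction `f ↦ f|_A`. -/
def restr (A : Set ℝ) : L2 k →L[ℂ] L2On k A := LpToLpRestrictCLM ℝ k ℂ halfLine 2 A

theorem past_union_future (t : ℝ≥0) : Set.Ico 0 (t : ℝ) ∪ Set.Ici (t : ℝ) = Set.Ici 0 :=
  Set.Ico_union_Ici_eq_Ici t.2

theorem past_disjoint_future (t : ℝ≥0) : Disjoint (Set.Ico 0 (t : ℝ)) (Set.Ici (t : ℝ)) :=
  Set.disjoint_left.2 fun _ hx hy => not_lt.2 hy hx.2

theorem inner_eq_past_add_future (t : ℝ≥0) (f g : L2 k) :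
    ⟪f, g⟫_ℂ = ⟪restr (Set.Ico 0 (t : ℝ)) f, restr (Set.Ico 0 (t : ℝ)) g⟫_ℂ +
      ⟪restr (Set.Ici (t : ℝ)) f, restr (Set.Ici (t : ℝ)) g⟫_ℂ := by
  have hr : ∀ A : Set ℝ, ⟪restr A f, restr A g⟫_ℂ = ∫ s in A, ⟪f s, g s⟫_ℂ ∂halfLine := by
    intro A
    rw [L2.inner_def]
    refine integral_congr_ae ?_
    filter_upwards [LpToLpRestrictCLM_coeFn ℂ A f, LpToLpRestrictCLM_coeFn ℂ A g] with s h1 h2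
    simp only [restr, h1, h2]
  have hint : Integrable (fun s => ⟪f s, g s⟫_ℂ) halfLine := L2.integrable_inner f g
  rw [hr, hr, ← setIntegral_union (past_disjoint_future t) measurableSet_Ici hint.integrableOn
    hint.integrableOn, past_union_future, L2.inner_def, Measure.restrict_restrict measurableSet_Ici,
    Set.inter_self]

theorem exists_glue (t : ℝ≥0) (f₁ : L2On k (Set.Ico 0 (t : ℝ))) (f₂ : L2On k (Set.Ici (t : ℝ))) :
    ∃ f : L2 k, restr (Set.Ico 0 (t : ℝ)) f = f₁ ∧ restr (Set.Ici (t : ℝ)) f = f₂ := by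
  have h1 : MemLp ((Set.Ico 0 (t : ℝ)).indicator f₁) 2 halfLine :=
    (memLp_indicator_iff_restrict measurableSet_Ico).2 (Lp.memLp f₁)
  have h2 : MemLp ((Set.Ici (t : ℝ)).indicator f₂) 2 halfLine :=
    (memLp_indicator_iff_restrict measurableSet_Ici).2 (Lp.memLp f₂)
  refine ⟨(h1.add h2).toLp _, Lp.ext ?_, Lp.ext ?_⟩
  · filter_upwards [LpToLpRestrictCLM_coeFn ℂ (Set.Ico 0 (t : ℝ)) ((h1.add h2).toLp _),
      ae_restrict_of_ae (s := Set.Ico 0 (t : ℝ)) (h1.add h2).coeFn_toLp,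
      ae_restrict_mem measurableSet_Ico] with s a b c
    rw [restr, a, b, Pi.add_apply, Set.indicator_of_mem c,
      Set.indicator_of_notMem (Set.disjoint_left.1 (past_disjoint_future t) c), add_zero]
  · filter_upwards [LpToLpRestrictCLM_coeFn ℂ (Set.Ici (t : ℝ)) ((h1.add h2).toLp _),
      ae_restrict_of_ae (s := Set.Ici (t : ℝ)) (h1.add h2).coeFn_toLp,
      ae_restrict_mem measurableSet_Ici] with s a b c
    rw [restr, a, b, Pi.add_apply, Set.indicator_of_mem c,
      Set.indicator_of_notMem (Set.disjoint_right.1 (past_disjoint_future t) c), zero_add]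

theorem inner_expVec_split (t : ℝ≥0) (f g : L2 k) :
    ⟪expVec f, expVec g⟫_ℂ =
      ⟪expVec (restr (Set.Ico 0 (t : ℝ)) f), expVec (restr (Set.Ico 0 (t : ℝ)) g)⟫_ℂ *
      ⟪expVec (restr (Set.Ici (t : ℝ)) f), expVec (restr (Set.Ici (t : ℝ)) g)⟫_ℂ := by
  rw [inner_expVec, inner_expVec, inner_expVec, ← Complex.exp_add, inner_eq_past_add_future t]

variable {h : Type*} [NormedAddCommGroup h] [InnerProductSpace ℂ h]

theorem span_id_dense {E : Type*} [NormedAddCommGroup E] [InnerProductSpace ℂ E] :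
    Dense (Submodule.span ℂ (Set.range (id : E → E)) : Set E) := by
  simp

theorem exists_split (t : ℝ≥0) :
    ∃ U : FockSpace k ≃ₗᵢ[ℂ] HTensor (FockPast k t) (FockFuture k t), ∀ f : L2 k,
      U (expVec f) =
        htmul (expVec (restr (Set.Ico 0 (t : ℝ)) f)) (expVec (restr (Set.Ici (t : ℝ)) f)) := by
  refine exists_unitary _ _ (fun f g => ?_) span_expVec_dense ?_
  · rw [inner_htmul, inner_expVec_split t]
  · refine (span_htmul_dense _ _ span_expVec_dense span_expVec_dense).mono
      (Submodule.span_mono ?_)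
    rintro _ ⟨⟨f₁, f₂⟩, rfl⟩
    obtain ⟨f, rfl, rfl⟩ := exists_glue t f₁ f₂
    exact ⟨f, rfl⟩

theorem exists_splitL (t : ℝ≥0) :
    ∃ U : HTensor h (FockSpace k) ≃ₗᵢ[ℂ] HTensor (HTensor h (FockPast k t)) (FockFuture k t),
      ∀ uf : h × L2 k, U (htmul uf.1 (expVec uf.2)) =
        htmul (htmul uf.1 (expVec (restr (Set.Ico 0 (t : ℝ)) uf.2)))
          (expVec (restr (Set.Ici (t : ℝ)) uf.2)) := by
  refine exists_unitary (fun uf : h × L2 k => htmul uf.1 (expVec uf.2))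
    (fun uf : h × L2 k => htmul (htmul uf.1 (expVec (restr (Set.Ico 0 (t : ℝ)) uf.2)))
      (expVec (restr (Set.Ici (t : ℝ)) uf.2))) (fun f g => ?_)
    (span_htmul_dense (id : h → h) (expVec : L2 k → FockSpace k) span_id_dense
      span_expVec_dense) ?_
  · rw [inner_htmul, inner_htmul, inner_htmul, inner_expVec_split t, mul_assoc]
  · refine (span_htmul_dense _ _ (span_htmul_dense (id : h → h)
      (expVec : L2On k (Set.Ico 0 (t : ℝ)) → FockPast k t) span_id_dense span_expVec_dense)
      (span_expVec_dense (H := L2On k (Set.Ici (t : ℝ))))).mono (Submodule.span_mono ?_)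
    rintro _ ⟨⟨⟨u, f₁⟩, f₂⟩, rfl⟩
    obtain ⟨f, rfl, rfl⟩ := exists_glue t f₁ f₂
    exact ⟨(u, f), rfl⟩

theorem exists_splitR (t : ℝ≥0) :
    ∃ U : HTensor h (FockSpace k) ≃ₗᵢ[ℂ] HTensor (FockPast k t) (HTensor h (FockFuture k t)),
      ∀ uf : h × L2 k, U (htmul uf.1 (expVec uf.2)) =
        htmul (expVec (restr (Set.Ico 0 (t : ℝ)) uf.2))
          (htmul uf.1 (expVec (restr (Set.Ici (t : ℝ)) uf.2))) := by
  refine exists_unitary (fun uf : h × L2 k => htmul uf.1 (expVec uf.2))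
    (fun uf : h × L2 k => htmul (expVec (restr (Set.Ico 0 (t : ℝ)) uf.2))
      (htmul uf.1 (expVec (restr (Set.Ici (t : ℝ)) uf.2)))) (fun f g => ?_)
    (span_htmul_dense (id : h → h) (expVec : L2 k → FockSpace k) span_id_dense
      span_expVec_dense) ?_
  · rw [inner_htmul, inner_htmul, inner_htmul, inner_expVec_split t, mul_left_comm]
  · refine (span_htmul_dense _ _ (span_expVec_dense (H := L2On k (Set.Ico 0 (t : ℝ))))
      (span_htmul_dense (id : h → h)
        (expVec : L2On k (Set.Ici (t : ℝ)) → FockFuture k t) span_id_dense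
        span_expVec_dense)).mono (Submodule.span_mono ?_)
    rintro _ ⟨⟨f₁, ⟨u, f₂⟩⟩, rfl⟩
    obtain ⟨f, rfl, rfl⟩ := exists_glue t f₁ f₂
    exact ⟨(u, f), rfl⟩

/-- The unitary `𝓕 ≅ 𝓕_{t)} ⊗ 𝓕_{[t}`, `ε f ↦ ε (f|_{[0,t)}) ⊗ ε (f|_{[t,∞)})`. -/
def split (t : ℝ≥0) : FockSpace k ≃ₗᵢ[ℂ] HTensor (FockPast k t) (FockFuture k t) :=
  (exists_split t).choose

/-- The unitary `h ⊗ 𝓕 ≅ (h ⊗ 𝓕_{t)}) ⊗ 𝓕_{[t}`,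
`u ⊗ ε f ↦ (u ⊗ ε (f|_{[0,t)})) ⊗ ε (f|_{[t,∞)})`. -/
def splitL (t : ℝ≥0) :
    HTensor h (FockSpace k) ≃ₗᵢ[ℂ] HTensor (HTensor h (FockPast k t)) (FockFuture k t) :=
  (exists_splitL t).choose

/-- The unitary `h ⊗ 𝓕 ≅ 𝓕_{t)} ⊗ (h ⊗ 𝓕_{[t})`,
`u ⊗ ε f ↦ ε (f|_{[0,t)}) ⊗ (u ⊗ ε (f|_{[t,∞)}))`. -/
def splitR (t : ℝ≥0) :
    HTensor h (FockSpace k) ≃ₗᵢ[ℂ] HTensor (FockPast k t) (HTensor h (FockFuture k t)) :=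
  (exists_splitR t).choose

/-- The operator on `E` corresponding to the operator `T` on `G` under a unitary `U : E ≅ G`. -/
def pullOp {E G : Type*} [NormedAddCommGroup E] [InnerProductSpace ℂ E]
    [NormedAddCommGroup G] [InnerProductSpace ℂ G] (U : E ≃ₗᵢ[ℂ] G) (T : G →L[ℂ] G) :
    E →L[ℂ] E :=
  (U.symm.toContinuousLinearEquiv : G →L[ℂ] E) ∘L T ∘L (U.toContinuousLinearEquiv : E →L[ℂ] G)

/-- `X ⊗ Y` for `X ∈ B(𝓕_{t)})` and `Y ∈ B(𝓕_{[t})`, acting on `𝓕`. -/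
def tensorAt (t : ℝ≥0) (X : FockPast k t →L[ℂ] FockPast k t)
    (Y : FockFuture k t →L[ℂ] FockFuture k t) : FockSpace k →L[ℂ] FockSpace k :=
  pullOp (split t) (opTensor X Y)

/-- `X ⊗ Y` for `X ∈ B(h ⊗ 𝓕_{t)})` and `Y ∈ B(𝓕_{[t})`, acting on `h ⊗ 𝓕`. -/
def tensorAtL (t : ℝ≥0) (X : HTensor h (FockPast k t) →L[ℂ] HTensor h (FockPast k t))
    (Y : FockFuture k t →L[ℂ] FockFuture k t) :
    HTensor h (FockSpace k) →L[ℂ] HTensor h (FockSpace k) :=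
  pullOp (splitL t) (opTensor X Y)

/-- The second quantisation of an orthogonal projection `Q` on `H`: the orthogonal projection onto
the closed linear span of `{ε (Q f)}`. -/
def secondQuantProj {H : Type*} [NormedAddCommGroup H] [InnerProductSpace ℂ H] (Q : H → H) :
    Fock H →L[ℂ] Fock H :=
  (Submodule.span ℂ (Set.range fun f : H => expVec (Q f))).topologicalClosure.starProjection

theorem secondQuantProj_expVec {H : Type*} [NormedAddCommGroup H] [InnerProductSpace ℂ H]
    (Q : H → H) (hQ : ∀ f g, ⟪Q f, Q g⟫_ℂ = ⟪Q f, g⟫_ℂ) (f : H) :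
    secondQuantProj Q (expVec f) = expVec (Q f) := by
  refine Submodule.eq_starProjection_of_mem_orthogonal
    (Submodule.le_topologicalClosure _ (Submodule.subset_span (Set.mem_range_self f))) ?_
  rw [Submodule.orthogonal_closure, Submodule.mem_orthogonal]
  intro x hx
  induction hx using Submodule.span_induction with
  | mem x hx =>
    obtain ⟨g, rfl⟩ := hx
    rw [inner_sub_right, inner_expVec, inner_expVec, hQ, sub_self]
  | zero => exact inner_zero_left _
  | add x y _ _ hx hy => rw [inner_add_left, hx, hy, add_zero]
  | smul c x _ hx => rw [inner_smul_left, hx, mul_zero]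

/-- `1_{[0,t)} f`. -/
def truncate (t : ℝ≥0) (f : L2 k) : L2 k :=
  ((Lp.memLp f).indicator (measurableSet_Ico (a := (0 : ℝ)) (b := (t : ℝ)))).toLp _

/-- The time projections: `E_t ε(f) = ε(1_{[0,t)} f)` for `t < ∞`, and `E_∞ = I`. -/
def timeProj (t : ℝ≥0∞) : FockSpace k →L[ℂ] FockSpace k :=
  if t = ⊤ then 1 else secondQuantProj (truncate t.toNNReal)

theorem measurePreserving_shift (t : ℝ≥0) :
    MeasurePreserving (fun s : ℝ => s - (t : ℝ)) (halfLine.restrict (Set.Ici (t : ℝ)))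
      halfLine := by
  have h := (measurePreserving_sub_right (volume : Measure ℝ) (t : ℝ)).restrict_preimage
    (measurableSet_Ici (a := (0 : ℝ)))
  have h1 : (fun s : ℝ => s - (t : ℝ)) ⁻¹' Set.Ici 0 = Set.Ici (t : ℝ) := by
    ext s; simp
  have h2 : halfLine.restrict (Set.Ici (t : ℝ)) = (volume : Measure ℝ).restrict (Set.Ici (t : ℝ)) := by
    rw [Measure.restrict_restrict measurableSet_Ici, Set.inter_eq_left.2]
    exact Set.Ici_subset_Ici.2 t.2
  rw [h1] at h
  rw [h2]
  exact h

/-- The right shift `θ_t`, `(θ_t f)(s) = f(s - t)` for `s ≥ t`, as an isometry from `L²(ℝ₊; k)` into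
`L²([t,∞); k)`. -/
def shift (t : ℝ≥0) : L2 k →ₗᵢ[ℂ] L2On k (Set.Ici (t : ℝ)) :=
  Lp.compMeasurePreservingₗᵢ ℂ _ (measurePreserving_shift t)

theorem exists_secondQuantShift (t : ℝ≥0) :
    ∃ U : FockSpace k →ₗᵢ[ℂ] FockFuture k t, ∀ f : L2 k, U (expVec f) = expVec (shift t f) := by
  refine exists_isometry _ _ (fun f g => ?_) span_expVec_dense
  rw [inner_expVec, inner_expVec, LinearIsometry.inner_map_map]

/-- `Γ_t : 𝓕 → 𝓕_{[t}`, `ε f ↦ ε (θ_t f)`. -/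
def secondQuantShift (t : ℝ≥0) : FockSpace k →L[ℂ] FockFuture k t :=
  (exists_secondQuantShift t).choose.toContinuousLinearMap

/-- The CCR flow, extended by ampliation to `B(h ⊗ 𝓕)`:
`σ_t(X) = I_{t)} ⊗ (I_h ⊗ Γ_t) X (I_h ⊗ Γ_t)^*`. -/
def ccrFlow (t : ℝ≥0) (X : HTensor h (FockSpace k) →L[ℂ] HTensor h (FockSpace k)) :
    HTensor h (FockSpace k) →L[ℂ] HTensor h (FockSpace k) :=
  pullOp (splitR t) (opTensor (1 : FockPast k t →L[ℂ] FockPast k t)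
    (opTensor (1 : h →L[ℂ] h) (secondQuantShift t) ∘L X ∘L
      ContinuousLinearMap.adjoint (opTensor (1 : h →L[ℂ] h) (secondQuantShift t))))

end Time

section StopTime

variable (k : Type*) [NormedAddCommGroup k] [InnerProductSpace ℂ k]

/-- A quantum stop time: an identity-adapted spectral measure on the Borel sets of `[0, ∞]`.
Only the values on measurable sets are relevant. -/
structure QuantumStopTime where
  /-- The underlying projection-valued set function. -/
  proj : Set ℝ≥0∞ → (FockSpace k →L[ℂ] FockSpace k)
  isStarProjection : ∀ A, MeasurableSet A → IsStarProjection (proj A)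
  isMeasure : ∀ x y : FockSpace k, ∃ m : ComplexMeasure ℝ≥0∞,
    ∀ A, MeasurableSet A → m A = ⟪x, proj A y⟫_ℂ
  proj_univ : proj Set.univ = 1
  proj_zero : ∃ c : ℂ, proj {0} = c • (1 : FockSpace k →L[ℂ] FockSpace k)
  adapted : ∀ t : ℝ≥0, 0 < t →
    ∃ X : FockPast k t →L[ℂ] FockPast k t, proj (Set.Icc 0 (t : ℝ≥0∞)) = tensorAt t X 1

variable {k}

/-- Finite partitions `{0 = π₀ < ⋯ < π_{n+1} = t}` of `[0, t]`, ordered by refinement. -/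
abbrev TimePartition (t : ℝ≥0∞) : Type :=
  {π : Finset ℝ≥0∞ // 0 ∈ π ∧ t ∈ π ∧ ∀ s ∈ π, s ≤ t}

/-- The point `π_{j-1}` of the partition which precedes `s = π_j`. -/
def TimePartition.pred {t : ℝ≥0∞} (π : TimePartition t) (s : ℝ≥0∞) : ℝ≥0∞ :=
  (π.1.filter (· < s)).sup id

/-- `T` converges strongly to `W` along the filter `l`. -/
def HasStrongLim {ι E : Type*} [NormedAddCommGroup E] [InnerProductSpace ℂ E] (l : Filter ι)
    (T : ι → E →L[ℂ] E) (W : E →L[ℂ] E) : Prop :=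
  ∀ z, Tendsto (fun i => T i z) l (𝓝 (W z))

open Classical in
/-- The strong limit of `T` along `l` (zero if there is none). -/
def strongLim {ι E : Type*} [NormedAddCommGroup E] [InnerProductSpace ℂ E] (l : Filter ι)
    (T : ι → E →L[ℂ] E) : E →L[ℂ] E :=
  if hT : ∃ W, HasStrongLim l T W then hT.choose else 0

/-- `E_{S,π} = ∑ⱼ S((π_{j-1}, π_j]) E_{π_j}`. -/
def timeProjSum (S : QuantumStopTime k) {t : ℝ≥0∞} (π : TimePartition t) :
    FockSpace k →L[ℂ] FockSpace k :=
  ∑ s ∈ π.1.erase 0, S.proj (Set.Ioc (π.pred s) s) ∘L timeProj s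

/-- The time projection `E_{S,t}`, the strong limit of `E_{S,π}` as the partition `π` of `[0, t]` is
refined. -/
def stoppedTimeProj (S : QuantumStopTime k) (t : ℝ≥0∞) : FockSpace k →L[ℂ] FockSpace k :=
  strongLim atTop (fun π : TimePartition t => timeProjSum S π)

end StopTime

section Cocycle

variable {k : Type*} [NormedAddCommGroup k] [InnerProductSpace ℂ k]
  {h : Type*} [NormedAddCommGroup h] [InnerProductSpace ℂ h]

variable (h) in
/-- The ampliation `I_h ⊗ X` of an operator `X` on `𝓕`. -/
def ampl (X : FockSpace k →L[ℂ] FockSpace k) :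
    HTensor h (FockSpace k) →L[ℂ] HTensor h (FockSpace k) :=
  opTensor 1 X

/-- `P_{[t}`: the second quantisation of the projection `p` acting pointwise on `L²([t,∞); k)`. -/
def futureProj (p : k →L[ℂ] k) (t : ℝ≥0) : FockFuture k t →L[ℂ] FockFuture k t :=
  secondQuantProj (p.compLpL 2 (halfLine.restrict (Set.Ici (t : ℝ))))

/-- `V` is a `p`-adapted process with values in the ultraweak tensor product of `𝒜` and `B(𝓕)`,
where `V_t = V_{t)} ⊗ P_{[t}` and `Vpast t` is `V_{t)}`. -/
structure IsAdaptedProcess [CompleteSpace h] (𝒜 : VonNeumannAlgebra h) (p : k →L[ℂ] k)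
    (V : ℝ≥0 → HTensor h (FockSpace k) →L[ℂ] HTensor h (FockSpace k))
    (Vpast : ∀ t : ℝ≥0, HTensor h (FockPast k t) →L[ℂ] HTensor h (FockPast k t)) : Prop where
  mem : ∀ t, V t ∈ vnTensor 𝒜 (FockSpace k)
  past_mem : ∀ t, Vpast t ∈ vnTensor 𝒜 (FockPast k t)
  eq_tensor : ∀ t, V t = tensorAtL t (Vpast t) (futureProj p t)

/-- `V` is an isometric `p`-adapted (left operator Markovian) cocycle for the CCR flow:
`V_{s+t} = (V_{s)} ⊗ I_{[s}) σ_s(V_t)` and each `V_{t)}` is an isometry. -/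
def IsIsometricCocycle [CompleteSpace h] (𝒜 : VonNeumannAlgebra h) (p : k →L[ℂ] k)
    (V : ℝ≥0 → HTensor h (FockSpace k) →L[ℂ] HTensor h (FockSpace k)) : Prop :=
  ∃ Vpast : ∀ t : ℝ≥0, HTensor h (FockPast k t) →L[ℂ] HTensor h (FockPast k t),
    IsAdaptedProcess 𝒜 p V Vpast ∧
    (∀ s t, V (s + t) = tensorAtL s (Vpast s) 1 ∘L ccrFlow s (V t)) ∧
    ∀ t, ContinuousLinearMap.adjoint (Vpast t) ∘L Vpast t = 1

/-- `V_{S,π} = ∑ⱼ V_{π_j} S((π_{j-1}, π_j])`, for a partition `π` of `[0, t]` with `t` finite. -/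
def cocycleSum (S : QuantumStopTime k)
    (V : ℝ≥0 → HTensor h (FockSpace k) →L[ℂ] HTensor h (FockSpace k)) {t : ℝ≥0}
    (π : TimePartition t) : HTensor h (FockSpace k) →L[ℂ] HTensor h (FockSpace k) :=
  ∑ s ∈ π.1.erase 0, V s.toNNReal ∘L ampl h (S.proj (Set.Ioc (π.pred s) s))

/-- The stopped cocycle: `V_{S,t}` is the strong limit of `V_{S,π}` as the partition `π` of `[0, t]`
is refined if `t < ∞`, and `V_{S,∞} = V_S` is the strong limit of `V_{S,r}` as `r → ∞`. -/
def stoppedCocycle (S : QuantumStopTime k)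
    (V : ℝ≥0 → HTensor h (FockSpace k) →L[ℂ] HTensor h (FockSpace k)) :
    ℝ≥0∞ → HTensor h (FockSpace k) →L[ℂ] HTensor h (FockSpace k)
  | some t => strongLim atTop (fun π : TimePartition (t : ℝ≥0∞) => cocycleSum S V π)
  | none => strongLim atTop fun r : ℝ≥0 =>
      strongLim atTop (fun π : TimePartition (r : ℝ≥0∞) => cocycleSum S V π)

end Cocycle

end StopCCR

end

open StopCCR

/-!
Write `S` also for the ampliation of the spectral measure to `h ⊗ 𝓕`, and call an operator on
`h ⊗ 𝓕 ≅ 𝓕_{b)} ⊗ (h ⊗ 𝓕_{[b})` past at `b` if it has the form `X ⊗ 1`, and future at `b` if it has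
the form `1 ⊗ Y`. Past and future operators commute, and on a product vector `z = u ⊗ ε f` they are
independent: `‖z‖² ⟪A z, M A z⟫ = ‖A z‖² ⟪z, M z⟫` for `A` past and `M` future
(`ampl_tensorAt_comm`, `norm_sq_mul_inner_pastFuture`).

The projection `S((a, b])` is past at `b` (`QuantumStopTime.exists_proj_Ioc_eq_tensorAt`). For
`r, s ≥ b` the cocycle identity and the isometry of `V_{b)}` give
`V_r^* V_s = σ_b(V_{r-b})^* σ_b(V_{s-b})`, which is future at `b`
(`IsIsometricCocycle.exists_adjoint_comp_eq`). This holds for every projection `p`, so convergence is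
the same for vacuum and identity adapted cocycles:

* the vectors `V_r S((π_{i-1}, π_i]) x` and `V_{r'} S((π_{j-1}, π_j]) y` are orthogonal for `i ≠ j`,
  `r ≥ π_i` and `r' ≥ π_j` (`IsIsometricCocycle.inner_eq_zero_of_ne`), so that each `V_{S,π}` is a
  contraction;
* if `π'` refines `π`, then `V_{S,π'} - V_{S,π}` is a sum over the intervals of `π'` of the operators
  `(V_s - V_{s'}) S((pred s, s])`, where `s'` is the first point of `π` with `s' ≥ s`. The terms are
  orthogonal, and on a product vector `z` independence gives
  `‖(V_{S,π'} - V_{S,π}) z‖² ≤ sup ‖(V_s - V_{s'}) z‖²`, which is small by uniform continuity of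
  `s ↦ V_s z` on `[0, t]`. Product vectors are total, so `V_{S,t}` exists
  (`IsIsometricCocycle.hasStrongLim_cocycleSum`).

Since `V_{S,t} S([0, r]) = V_{S,r}` for `r ≤ t` and `S([0, r]) → 1`, the limit as `t → ∞` exists too
(`IsIsometricCocycle.hasStrongLim_stoppedCocycle`). The operators `E_{S,π}` are projections which
decrease as `π` is refined, so `E_{S,t}` exists (`hasStrongLim_timeProjSum`).

Finally `‖V_{S,π} z‖² = ∑ⱼ ‖V_{π_j} S((π_{j-1}, π_j]) z‖²`. In the vacuum adapted case
`V_t^* V_t = E_t` commutes with `S((a, t])`, and the sum is `‖E_{S,π} z‖²`; in the identity adapted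
case `V_t^* V_t = 1`, and the sum is `‖S([0, t]) z‖²`. Both identities pass to the limit, and
`V_{S,t} E_{S,t} = V_{S,t}` follows from the first because `E_{S,t}` is idempotent.
-/

namespace StopCCR

/-! ### Spectral measures -/

section SpectralMeasure

variable {k : Type*} [NormedAddCommGroup k] [InnerProductSpace ℂ k]

theorem QuantumStopTime.proj_biUnion (S : QuantumStopTime k) {ι : Type*} (s : Finset ι)
    (A : ι → Set ℝ≥0∞) (hA : ∀ i ∈ s, MeasurableSet (A i))
    (hd : Set.PairwiseDisjoint (s : Set ι) A) :
    S.proj (⋃ i ∈ s, A i) = ∑ i ∈ s, S.proj (A i) := by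
  refine ContinuousLinearMap.ext fun y => ext_inner_left ℂ fun x => ?_
  obtain ⟨m, hm⟩ := S.isMeasure x y
  rw [← hm _ (Finset.measurableSet_biUnion s hA), VectorMeasure.of_biUnion_finset hd hA,
    _root_.sum_apply, inner_sum]
  exact Finset.sum_congr rfl fun i hi => hm _ (hA i hi)

theorem QuantumStopTime.proj_union (S : QuantumStopTime k) {A B : Set ℝ≥0∞}
    (hA : MeasurableSet A) (hB : MeasurableSet B) (hd : Disjoint A B) :
    S.proj (A ∪ B) = S.proj A + S.proj B := by
  refine ContinuousLinearMap.ext fun y => ext_inner_left ℂ fun x => ?_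
  obtain ⟨m, hm⟩ := S.isMeasure x y
  rw [← hm _ (hA.union hB), VectorMeasure.of_union hd hA hB, _root_.add_apply,
    inner_add_right, hm _ hA, hm _ hB]

theorem QuantumStopTime.proj_mul_self (S : QuantumStopTime k) {A : Set ℝ≥0∞}
    (hA : MeasurableSet A) : S.proj A * S.proj A = S.proj A :=
  (S.isStarProjection A hA).isIdempotentElem

/-- If `P`, `Q` and `P + Q` are idempotents then `PQ = -QP`, and multiplying by `P` on either side
gives `PQ = QP`; so the projections of disjoint sets are mutually orthogonal. -/
theorem QuantumStopTime.proj_mul_of_disjoint (S : QuantumStopTime k) {A B : Set ℝ≥0∞}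
    (hA : MeasurableSet A) (hB : MeasurableSet B) (hd : Disjoint A B) :
    S.proj A * S.proj B = 0 := by
  have h1 := S.proj_mul_self (hA.union hB)
  rw [S.proj_union hA hB hd] at h1
  have hP := S.proj_mul_self hA
  have hQ := S.proj_mul_self hB
  set P := S.proj A
  set Q := S.proj B
  have h2 : P * Q + Q * P = 0 := by
    have : (P + Q) * (P + Q) = P * P + Q * Q + (P * Q + Q * P) := by noncomm_ring
    rw [this, hP, hQ] at h1
    simpa using h1
  have h3 : P * Q + P * Q * P = 0 := by
    have := congrArg (P * ·) h2
    simp only [mul_add, mul_zero] at this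
    rwa [← mul_assoc, hP, ← mul_assoc] at this
  have h4 : P * Q * P + Q * P = 0 := by
    have := congrArg (· * P) h2
    simp only [add_mul, zero_mul] at this
    rwa [mul_assoc Q P P, hP] at this
  have h5 : P * Q = Q * P := by
    rw [eq_neg_of_add_eq_zero_left h3, eq_neg_of_add_eq_zero_right h4]
  rw [← h5, ← two_smul ℂ] at h2
  exact (smul_eq_zero.1 h2).resolve_left two_ne_zero

theorem QuantumStopTime.proj_mul_of_subset (S : QuantumStopTime k) {A B : Set ℝ≥0∞}
    (hA : MeasurableSet A) (hB : MeasurableSet B) (h : A ⊆ B) :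
    S.proj B * S.proj A = S.proj A := by
  have h1 : S.proj B = S.proj A + S.proj (B \ A) := by
    rw [← S.proj_union hA (hB.diff hA) Set.disjoint_sdiff_right, Set.union_sdiff_cancel h]
  rw [h1, add_mul, S.proj_mul_self hA,
    S.proj_mul_of_disjoint (hB.diff hA) hA Set.disjoint_sdiff_left, add_zero]

theorem QuantumStopTime.proj_mul_proj (S : QuantumStopTime k) {A B : Set ℝ≥0∞}
    (hA : MeasurableSet A) (hB : MeasurableSet B) :
    S.proj A * S.proj B = S.proj (A ∩ B) := by
  have h1 : S.proj B = S.proj (A ∩ B) + S.proj (B \ A) := by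
    rw [← S.proj_union (hA.inter hB) (hB.diff hA)
      (Set.disjoint_left.2 fun x hx hx' => hx'.2 hx.1), Set.inter_comm, Set.inter_union_sdiff]
  rw [h1, mul_add, S.proj_mul_of_subset (hA.inter hB) hA Set.inter_subset_left,
    S.proj_mul_of_disjoint hA (hB.diff hA) Set.disjoint_sdiff_right, add_zero]

theorem QuantumStopTime.proj_Ioc (S : QuantumStopTime k) {a b : ℝ≥0∞} (hab : a ≤ b) :
    S.proj (Set.Ioc a b) = S.proj (Set.Icc 0 b) - S.proj (Set.Icc 0 a) := by
  rw [eq_sub_iff_add_eq', ← S.proj_union measurableSet_Icc measurableSet_Ioc,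
    Set.Icc_union_Ioc_eq_Icc zero_le hab]
  exact Set.disjoint_left.2 fun x hx hx' => not_lt.2 hx.2 hx'.1

theorem QuantumStopTime.proj_Ioc_zero (S : QuantumStopTime k) (hS : S.proj {0} = 0) (b : ℝ≥0∞) :
    S.proj (Set.Ioc 0 b) = S.proj (Set.Icc 0 b) := by
  rw [S.proj_Ioc zero_le, Set.Icc_self, hS, sub_zero]

end SpectralMeasure

/-! ### Partitions and their refinements -/

section Partition

variable {t : ℝ≥0∞}

instance : Nonempty (TimePartition t) :=
  ⟨⟨{0, t}, by simp, by simp, by simp⟩⟩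

/-- The common refinement makes the partitions of `[0, t]` a semilattice. -/
noncomputable instance : SemilatticeSup (TimePartition t) :=
  Subtype.semilatticeSup fun _ _ hx hy =>
    ⟨Finset.mem_union_left _ hx.1, Finset.mem_union_left _ hx.2.1, fun s hs =>
      (Finset.mem_union.1 hs).elim (hx.2.2 s) (hy.2.2 s)⟩

/-- The first point of the partition which is not before `x`. -/
noncomputable def TimePartition.next (π : TimePartition t) (x : ℝ≥0∞) : ℝ≥0∞ :=
  (π.1.filter (x ≤ ·)).inf id

theorem TimePartition.le_next (π : TimePartition t) (x : ℝ≥0∞) : x ≤ π.next x :=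
  Finset.le_inf fun _ hc => (Finset.mem_filter.1 hc).2

theorem TimePartition.next_le (π : TimePartition t) {x c : ℝ≥0∞} (hc : c ∈ π.1) (hx : x ≤ c) :
    π.next x ≤ c :=
  Finset.inf_le (f := id) (Finset.mem_filter.2 ⟨hc, hx⟩)

theorem TimePartition.next_mem (π : TimePartition t) {x : ℝ≥0∞} (hx : x ≤ t) :
    π.next x ∈ π.1 := by
  obtain ⟨c, hc, h⟩ := Finset.exists_mem_eq_inf (π.1.filter (x ≤ ·))
    ⟨t, Finset.mem_filter.2 ⟨π.2.2.1, hx⟩⟩ id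
  rw [TimePartition.next, h]
  exact (Finset.mem_filter.1 hc).1

theorem TimePartition.pred_lt_iff (π : TimePartition t) {s x : ℝ≥0∞} (hx : 0 < x) :
    π.pred s < x ↔ ∀ c ∈ π.1, c < s → c < x := by
  rw [TimePartition.pred, Finset.sup_lt_iff hx]
  simp

theorem TimePartition.le_pred (π : TimePartition t) {s c : ℝ≥0∞} (hc : c ∈ π.1) (h : c < s) :
    c ≤ π.pred s :=
  Finset.le_sup (f := id) (Finset.mem_filter.2 ⟨hc, h⟩)

theorem TimePartition.pred_lt (π : TimePartition t) {s : ℝ≥0∞} (hs : 0 < s) : π.pred s < s :=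
  (π.pred_lt_iff hs).2 fun _ _ h => h

theorem TimePartition.mem_Ioc_pred_iff (π : TimePartition t) {s x : ℝ≥0∞} (hs : s ∈ π.1) :
    x ∈ Set.Ioc (π.pred s) s ↔ 0 < x ∧ π.next x = s := by
  constructor
  · rintro ⟨h1, h2⟩
    refine ⟨pos_of_gt h1, le_antisymm (π.next_le hs h2) (not_lt.1 fun h => ?_)⟩
    have := π.le_pred (π.next_mem (h2.trans (π.2.2.2 s hs))) h
    exact absurd (h1.trans_le (π.le_next x)) (not_lt.2 this)
  · rintro ⟨h1, rfl⟩
    refine ⟨(π.pred_lt_iff h1).2 fun c hc h => ?_, π.le_next x⟩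
    by_contra! h'
    exact absurd h (not_lt.2 (π.next_le hc h'))

theorem TimePartition.pairwiseDisjoint_Ioc_pred (π : TimePartition t) :
    Set.PairwiseDisjoint (π.1 : Set ℝ≥0∞) fun s => Set.Ioc (π.pred s) s := by
  intro s hs s' hs' hne
  refine Set.disjoint_left.2 fun x hx hx' => hne ?_
  rw [← ((π.mem_Ioc_pred_iff hs).1 hx).2, ((π.mem_Ioc_pred_iff hs').1 hx').2]

theorem TimePartition.iUnion_Ioc_pred_of_le {π π' : TimePartition t} (hle : π ≤ π') {c : ℝ≥0∞}
    (hc : c ∈ π.1.erase 0) :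
    ⋃ s ∈ (π'.1.erase 0).filter (fun s => π.next s = c), Set.Ioc (π'.pred s) s =
      Set.Ioc (π.pred c) c := by
  have hc' := Finset.mem_of_mem_erase hc
  ext x
  simp only [Set.mem_iUnion, Finset.mem_filter, exists_prop]
  constructor
  · rintro ⟨s, ⟨hs, hsc⟩, hx⟩
    have hs0 : 0 < s := pos_iff_ne_zero.2 (Finset.ne_of_mem_erase hs)
    refine ⟨?_, hx.2.trans (hsc ▸ π.le_next s)⟩
    refine (π.pred_lt_iff (pos_of_gt hx.1)).2 fun d hd hdc => ?_
    have hds : d < s := by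
      by_contra! h
      exact absurd hdc (not_lt.2 (hsc ▸ π.next_le hd h))
    exact (π'.le_pred (hle hd) hds).trans_lt hx.1
  · intro hx
    have hxt : x ≤ t := hx.2.trans (π.2.2.2 c hc')
    have h0 : 0 < x := pos_of_gt hx.1
    have hm := π'.next_mem hxt
    have hn0 : 0 < π'.next x := h0.trans_le (π'.le_next x)
    refine ⟨π'.next x, ⟨Finset.mem_erase.2 ⟨hn0.ne', hm⟩, ?_⟩,
      (π'.mem_Ioc_pred_iff hm).2 ⟨h0, rfl⟩⟩
    exact ((π.mem_Ioc_pred_iff hc').1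
      ⟨hx.1.trans_le (π'.le_next x), π'.next_le (hle hc') hx.2⟩).2

/-- The part of a partition which lies in `[0, r]`, as a partition of `[0, r]`. -/
noncomputable def TimePartition.restrict (r : ℝ≥0∞) (π : TimePartition t) : TimePartition r :=
  ⟨insert 0 (insert r (π.1.filter (· ≤ r))), by simp, by simp, by simp⟩

theorem TimePartition.mem_restrict {r : ℝ≥0∞} {π : TimePartition t} (hr : r ∈ π.1) {s : ℝ≥0∞} :
    s ∈ (π.restrict r).1 ↔ s ∈ π.1 ∧ s ≤ r := by
  simp only [TimePartition.restrict, Finset.mem_insert, Finset.mem_filter]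
  constructor
  · rintro (rfl | rfl | h)
    · exact ⟨π.2.1, zero_le⟩
    · exact ⟨hr, le_rfl⟩
    · exact h
  · exact fun h => Or.inr (Or.inr h)

theorem TimePartition.pred_restrict {r : ℝ≥0∞} {π : TimePartition t} (hr : r ∈ π.1) {s : ℝ≥0∞}
    (hs : s ≤ r) : (π.restrict r).pred s = π.pred s := by
  rw [TimePartition.pred, TimePartition.pred]
  congr 1
  ext x
  simp only [Finset.mem_filter, TimePartition.mem_restrict hr]
  exact ⟨fun h => ⟨h.1.1, h.2⟩, fun h => ⟨⟨h.1, h.2.le.trans hs⟩, h.2⟩⟩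

/-- Every partition of `[0, r]` is refined by the restriction of some partition of `[0, t]`, so limits
over partitions of `[0, r]` can be computed along restrictions. -/
theorem TimePartition.tendsto_restrict {r : ℝ≥0∞} (hr : r ≤ t) :
    Tendsto (TimePartition.restrict r : TimePartition t → TimePartition r) atTop atTop := by
  refine tendsto_atTop_atTop.2 fun π => ⟨⟨insert t π.1, by simp [π.2.1], by simp, ?_⟩, ?_⟩
  · simp only [Finset.mem_insert]
    rintro s (rfl | hs)
    · exact le_rfl
    · exact (π.2.2.2 s hs).trans hr
  · intro π' hle s hs
    exact Finset.mem_insert_of_mem (Finset.mem_insert_of_mem (Finset.mem_filter.2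
      ⟨hle (Finset.mem_insert_of_mem hs), π.2.2.2 s hs⟩))

theorem TimePartition.eventually_mem {r : ℝ≥0∞} (hr : r ≤ t) :
    ∀ᶠ π : TimePartition t in atTop, r ∈ π.1 := by
  have h0 : r ∈ ({0, r, t} : Finset ℝ≥0∞) := by simp
  filter_upwards [eventually_ge_atTop
    (⟨{0, r, t}, by simp, by simp, by simp [hr]⟩ : TimePartition t)] with π hπ
  exact hπ h0

/-- A finite interval has partitions of arbitrarily small mesh. -/
theorem TimePartition.exists_mesh_le (t : ℝ≥0) {δ : ℝ≥0} (hδ : 0 < δ) :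
    ∃ π : TimePartition (t : ℝ≥0∞), ∀ s : ℝ≥0, s ≤ t → π.next s ≤ s + δ := by
  let p : Finset ℝ≥0∞ := insert (t : ℝ≥0∞)
    ((Finset.range (⌈t / δ⌉₊ + 1)).image fun i : ℕ => ((min (i * δ) t : ℝ≥0) : ℝ≥0∞))
  have hp : 0 ∈ p ∧ (t : ℝ≥0∞) ∈ p ∧ ∀ s ∈ p, s ≤ t := by
    refine ⟨?_, Finset.mem_insert_self _ _, ?_⟩
    · exact Finset.mem_insert_of_mem (Finset.mem_image.2 ⟨0, by simp, by simp⟩)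
    · intro s hs
      rcases Finset.mem_insert.1 hs with rfl | hs
      · exact le_rfl
      · obtain ⟨i, -, rfl⟩ := Finset.mem_image.1 hs
        exact_mod_cast min_le_right _ _
  refine ⟨⟨p, hp⟩, fun s hs => ?_⟩
  have hm : ((min (⌈s / δ⌉₊ * δ) t : ℝ≥0) : ℝ≥0∞) ∈ p := by
    refine Finset.mem_insert_of_mem (Finset.mem_image.2 ⟨⌈s / δ⌉₊, ?_, rfl⟩)
    rw [Finset.mem_range, Nat.lt_succ_iff]
    exact Nat.ceil_mono (div_le_div_of_nonneg_right hs hδ.le)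
  have h1 : s ≤ min (⌈s / δ⌉₊ * δ) t := by
    refine le_min ?_ hs
    rw [← div_le_iff₀ hδ]
    exact Nat.le_ceil _
  refine (TimePartition.next_le _ hm (by exact_mod_cast h1)).trans ?_
  have h2 : (⌈s / δ⌉₊ : ℝ≥0) * δ ≤ s + δ := by
    have := (Nat.ceil_lt_add_one (zero_le (a := s / δ))).le
    calc (⌈s / δ⌉₊ : ℝ≥0) * δ ≤ (s / δ + 1) * δ := by gcongr
      _ = s + δ := by rw [add_mul, one_mul, div_mul_cancel₀ _ hδ.ne']
  exact_mod_cast (min_le_left _ _).trans h2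

end Partition

/-! ### Riemann–Stieltjes sums against a spectral measure -/

section SpectralSum

variable {k : Type*} [NormedAddCommGroup k] [InnerProductSpace ℂ k] {t : ℝ≥0∞}
  {M : Type*} [AddCommMonoid M]

/-- `∑ⱼ G_{π_j} (S((π_{j-1}, π_j]))` for a family `G` of additive maps on `B(𝓕)`. -/
noncomputable def spectralSum (S : QuantumStopTime k)
    (G : ℝ≥0∞ → (FockSpace k →L[ℂ] FockSpace k) →+ M) (π : TimePartition t) : M :=
  ∑ s ∈ π.1.erase 0, G s (S.proj (Set.Ioc (π.pred s) s))

/-- The sum for `π` is also a sum over any refinement of `π`. -/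
theorem spectralSum_eq_of_le (S : QuantumStopTime k)
    (G : ℝ≥0∞ → (FockSpace k →L[ℂ] FockSpace k) →+ M) {π π' : TimePartition t} (hle : π ≤ π') :
    spectralSum S G π =
      ∑ s ∈ π'.1.erase 0, G (π.next s) (S.proj (Set.Ioc (π'.pred s) s)) := by
  have hmaps : ∀ s ∈ π'.1.erase 0, π.next s ∈ π.1.erase 0 := fun s hs =>
    Finset.mem_erase.2 ⟨((pos_iff_ne_zero.2 (Finset.ne_of_mem_erase hs)).trans_le
      (π.le_next s)).ne', π.next_mem (π'.2.2.2 s (Finset.mem_of_mem_erase hs))⟩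
  rw [spectralSum, ← Finset.sum_fiberwise_of_maps_to hmaps]
  refine Finset.sum_congr rfl fun c hc => ?_
  rw [← TimePartition.iUnion_Ioc_pred_of_le hle hc, S.proj_biUnion, map_sum]
  · exact Finset.sum_congr rfl fun s hs => by rw [(Finset.mem_filter.1 hs).2]
  · exact fun _ _ => measurableSet_Ioc
  · exact π'.pairwiseDisjoint_Ioc_pred.subset fun s hs =>
      Finset.mem_of_mem_erase (Finset.mem_filter.1 hs).1

theorem sum_proj_Ioc_pred (S : QuantumStopTime k) (π : TimePartition t) :
    ∑ s ∈ π.1.erase 0, S.proj (Set.Ioc (π.pred s) s) = S.proj (Set.Ioc 0 t) := by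
  rw [← S.proj_biUnion _ _ (fun _ _ => measurableSet_Ioc)
    (π.pairwiseDisjoint_Ioc_pred.subset fun s hs => Finset.mem_of_mem_erase hs)]
  congr 1
  ext x
  simp only [Set.mem_iUnion, exists_prop]
  constructor
  · rintro ⟨s, hs, hx⟩
    exact ⟨pos_of_gt hx.1, hx.2.trans (π.2.2.2 s (Finset.mem_of_mem_erase hs))⟩
  · intro hx
    have hm := π.next_mem hx.2
    exact ⟨π.next x, Finset.mem_erase.2 ⟨(hx.1.trans_le (π.le_next x)).ne', hm⟩,
      (π.mem_Ioc_pred_iff hm).2 ⟨hx.1, rfl⟩⟩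

/-- Cutting the spectral measure off at a point `r` of the partition leaves the sum for the part of
the partition in `[0, r]`. -/
theorem spectralSum_restrict (S : QuantumStopTime k)
    (G : ℝ≥0∞ → (FockSpace k →L[ℂ] FockSpace k) →+ M) {π : TimePartition t} {r : ℝ≥0∞}
    (hr : r ∈ π.1) :
    spectralSum S G (π.restrict r) = ∑ s ∈ π.1.erase 0,
      G s (S.proj (Set.Icc 0 r) * S.proj (Set.Ioc (π.pred s) s)) := by
  have hsub : (π.restrict r).1.erase 0 ⊆ π.1.erase 0 := by
    intro s hs
    rw [Finset.mem_erase, TimePartition.mem_restrict hr] at hs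
    exact Finset.mem_erase.2 ⟨hs.1, hs.2.1⟩
  rw [spectralSum, ← Finset.sum_subset hsub]
  · refine Finset.sum_congr rfl fun s hs => ?_
    rw [Finset.mem_erase, TimePartition.mem_restrict hr] at hs
    rw [TimePartition.pred_restrict hr hs.2.2, S.proj_mul_of_subset measurableSet_Ioc
      measurableSet_Icc fun x hx => ⟨zero_le, hx.2.trans hs.2.2⟩]
  · intro s hs hs'
    rw [Finset.mem_erase] at hs
    have hlt : r < s := by
      by_contra! h
      exact hs' (Finset.mem_erase.2 ⟨hs.1, (TimePartition.mem_restrict hr).2 ⟨hs.2, h⟩⟩)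
    rw [S.proj_mul_of_disjoint measurableSet_Icc measurableSet_Ioc, map_zero]
    exact Set.disjoint_left.2 fun x hx hx' =>
      not_lt.2 (hx.2.trans (π.le_pred hr hlt)) hx'.1

end SpectralSum


/-! ### Operators on Hilbert-space tensor products -/

section TensorOperators

variable {E F : Type*} [NormedAddCommGroup E] [InnerProductSpace ℂ E]
  [NormedAddCommGroup F] [InnerProductSpace ℂ F]

/-- Operators with the same matrix elements on total families are equal. -/
theorem eq_of_inner_total {ι κ : Type*} {a : ι → F} {b : κ → E}
    (ha : Dense (Submodule.span ℂ (Set.range a) : Set F))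
    (hb : Dense (Submodule.span ℂ (Set.range b) : Set E)) {T T' : E →L[ℂ] F}
    (h : ∀ i j, ⟪a i, T (b j)⟫_ℂ = ⟪a i, T' (b j)⟫_ℂ) : T = T' := by
  refine ContinuousLinearMap.ext_on hb ?_
  rintro _ ⟨j, rfl⟩
  have key : innerSL ℂ (T (b j)) = innerSL ℂ (T' (b j)) := by
    refine ContinuousLinearMap.ext_on ha ?_
    rintro _ ⟨i, rfl⟩
    rw [innerSL_apply_apply, innerSL_apply_apply, ← inner_conj_symm, h, inner_conj_symm]
  exact (innerSL_inj (𝕜 := ℂ)).1 key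

theorem inner_pullOp (U : E ≃ₗᵢ[ℂ] F) (T : F →L[ℂ] F) (w z : E) :
    ⟪w, pullOp U T z⟫_ℂ = ⟪U w, T (U z)⟫_ℂ := by
  rw [← U.inner_map_map]
  change ⟪U w, U (U.symm (T (U z)))⟫_ℂ = _
  rw [U.apply_symm_apply]

theorem inner_pullOp_left (U : E ≃ₗᵢ[ℂ] F) (T : F →L[ℂ] F) (w z : E) :
    ⟪pullOp U T w, z⟫_ℂ = ⟪T (U w), U z⟫_ℂ := by
  rw [← inner_conj_symm, inner_pullOp, inner_conj_symm]

theorem pullOp_comp (U : E ≃ₗᵢ[ℂ] F) (T T' : F →L[ℂ] F) :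
    pullOp U T ∘L pullOp U T' = pullOp U (T ∘L T') := by
  ext z
  change U.symm (T (U (U.symm (T' (U z))))) = U.symm (T (T' (U z)))
  rw [U.apply_symm_apply]

theorem adjoint_pullOp [CompleteSpace E] [CompleteSpace F] (U : E ≃ₗᵢ[ℂ] F) (T : F →L[ℂ] F) :
    ContinuousLinearMap.adjoint (pullOp U T) = pullOp U (ContinuousLinearMap.adjoint T) := by
  refine (ContinuousLinearMap.eq_adjoint_iff _ _).2 (fun x y => ?_) |>.symm
  rw [inner_pullOp_left, ContinuousLinearMap.adjoint_inner_left, inner_pullOp]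

theorem span_htmul_id_dense :
    Dense (Submodule.span ℂ (Set.range fun i : E × F => htmul i.1 i.2) : Set (HTensor E F)) :=
  span_htmul_dense (id : E → E) (id : F → F) span_id_dense span_id_dense

theorem htmul_add (x : E) (y y' : F) : htmul x (y + y') = htmul x y + htmul x y' := by
  simp only [htmul, TensorProduct.tmul_add, UniformSpace.Completion.coe_add]

theorem htmul_sub (x : E) (y y' : F) : htmul x (y - y') = htmul x y - htmul x y' := by
  rw [eq_sub_iff_add_eq, ← htmul_add, sub_add_cancel]

theorem sub_htmul (x x' : E) (y : F) : htmul (x - x') y = htmul x y - htmul x' y := by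
  rw [eq_sub_iff_add_eq]
  simp only [htmul, ← UniformSpace.Completion.coe_add, ← TensorProduct.add_tmul, sub_add_cancel]

theorem norm_htmul (x : E) (y : F) : ‖htmul x y‖ = ‖x‖ * ‖y‖ := by
  have h := inner_htmul x x y y
  rw [inner_self_eq_norm_sq_to_K, inner_self_eq_norm_sq_to_K, inner_self_eq_norm_sq_to_K,
    ← mul_pow] at h
  have h' : ‖htmul x y‖ ^ 2 = (‖x‖ * ‖y‖) ^ 2 := by exact_mod_cast h
  exact (pow_left_inj₀ (norm_nonneg _) (by positivity) two_ne_zero).1 h'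

theorem opTensor_comp (A A' : E →L[ℂ] E) (B B' : F →L[ℂ] F) :
    opTensor A B ∘L opTensor A' B' = opTensor (A ∘L A') (B ∘L B') := by
  refine ContinuousLinearMap.ext_on span_htmul_id_dense ?_
  rintro _ ⟨i, rfl⟩
  simp [opTensor_htmul]

theorem opTensor_one_one : opTensor (1 : E →L[ℂ] E) (1 : F →L[ℂ] F) = 1 := by
  refine ContinuousLinearMap.ext_on span_htmul_id_dense ?_
  rintro _ ⟨i, rfl⟩
  simp [opTensor_htmul]

theorem opTensor_add (A : E →L[ℂ] E) (B B' : F →L[ℂ] F) :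
    opTensor A (B + B') = opTensor A B + opTensor A B' := by
  refine ContinuousLinearMap.ext_on span_htmul_id_dense ?_
  rintro _ ⟨i, rfl⟩
  simp [opTensor_htmul, htmul_add]

theorem sub_opTensor (A A' : E →L[ℂ] E) (B : F →L[ℂ] F) :
    opTensor (A - A') B = opTensor A B - opTensor A' B := by
  refine ContinuousLinearMap.ext_on span_htmul_id_dense ?_
  rintro _ ⟨i, rfl⟩
  simp [opTensor_htmul, sub_htmul]

theorem adjoint_opTensor [CompleteSpace E] [CompleteSpace F] (A : E →L[ℂ] E) (B : F →L[ℂ] F) :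
    ContinuousLinearMap.adjoint (opTensor A B) =
      opTensor (ContinuousLinearMap.adjoint A) (ContinuousLinearMap.adjoint B) := by
  refine eq_of_inner_total span_htmul_id_dense span_htmul_id_dense fun i j => ?_
  rw [ContinuousLinearMap.adjoint_inner_right, opTensor_htmul, opTensor_htmul, inner_htmul,
    inner_htmul, ContinuousLinearMap.adjoint_inner_right, ContinuousLinearMap.adjoint_inner_right]

/-- On a product vector, the operators `X ⊗ 1` and `1 ⊗ Y` are independent in the vector state. -/
theorem norm_sq_mul_inner_of_eq_htmul {G : Type*} [NormedAddCommGroup G] [InnerProductSpace ℂ G]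
    (U : G ≃ₗᵢ[ℂ] HTensor E F) (X : E →L[ℂ] E) (Y : F →L[ℂ] F) {z : G} {x : E} {y : F}
    (hz : U z = htmul x y) :
    (‖z‖ : ℂ) ^ 2 * ⟪pullOp U (opTensor X 1) z,
        pullOp U (opTensor 1 Y) (pullOp U (opTensor X 1) z)⟫_ℂ =
      (‖pullOp U (opTensor X 1) z‖ : ℂ) ^ 2 * ⟪z, pullOp U (opTensor 1 Y) z⟫_ℂ := by
  have hA : U (pullOp U (opTensor X 1) z) = htmul (X x) y := by
    change U (U.symm (opTensor X 1 (U z))) = _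
    rw [LinearIsometryEquiv.apply_symm_apply, hz, opTensor_htmul]
    rfl
  rw [inner_pullOp, inner_pullOp, ← U.norm_map z, ← U.norm_map (pullOp U _ z), hA, hz,
    opTensor_htmul, opTensor_htmul, inner_htmul, inner_htmul, norm_htmul, norm_htmul]
  have hn : ⟪x, x⟫_ℂ = (‖x‖ : ℂ) ^ 2 := inner_self_eq_norm_sq_to_K x
  have hn' : ⟪X x, X x⟫_ℂ = (‖X x‖ : ℂ) ^ 2 := inner_self_eq_norm_sq_to_K (X x)
  simp only [one_apply_eq_self, hn, hn']
  push_cast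
  ring

end TensorOperators

/-! ### Adaptedness: operators of the past and of the future -/

section Adapted

variable {k : Type*} [NormedAddCommGroup k] [InnerProductSpace ℂ k]
  {h : Type*} [NormedAddCommGroup h] [InnerProductSpace ℂ h]

theorem split_expVec (t : ℝ≥0) (f : L2 k) : split t (expVec f) =
    htmul (expVec (restr (Set.Ico 0 (t : ℝ)) f)) (expVec (restr (Set.Ici (t : ℝ)) f)) :=
  (exists_split t).choose_spec f

theorem splitL_htmul (t : ℝ≥0) (u : h) (f : L2 k) : splitL t (htmul u (expVec f)) =
    htmul (htmul u (expVec (restr (Set.Ico 0 (t : ℝ)) f)))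
      (expVec (restr (Set.Ici (t : ℝ)) f)) :=
  (exists_splitL t).choose_spec (u, f)

theorem splitR_htmul (t : ℝ≥0) (u : h) (f : L2 k) : splitR t (htmul u (expVec f)) =
    htmul (expVec (restr (Set.Ico 0 (t : ℝ)) f))
      (htmul u (expVec (restr (Set.Ici (t : ℝ)) f))) :=
  (exists_splitR t).choose_spec (u, f)

theorem span_htmul_expVec_dense :
    Dense (Submodule.span ℂ (Set.range fun uf : h × L2 k => htmul uf.1 (expVec uf.2)) :
      Set (HTensor h (FockSpace k))) :=
  span_htmul_dense (id : h → h) (expVec : L2 k → FockSpace k) span_id_dense span_expVec_dense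

theorem inner_tensorAt (t : ℝ≥0) (X : FockPast k t →L[ℂ] FockPast k t)
    (Y : FockFuture k t →L[ℂ] FockFuture k t) (f g : L2 k) :
    ⟪expVec f, tensorAt t X Y (expVec g)⟫_ℂ =
      ⟪expVec (restr (Set.Ico 0 (t : ℝ)) f), X (expVec (restr (Set.Ico 0 (t : ℝ)) g))⟫_ℂ *
      ⟪expVec (restr (Set.Ici (t : ℝ)) f), Y (expVec (restr (Set.Ici (t : ℝ)) g))⟫_ℂ := by
  rw [tensorAt, inner_pullOp, split_expVec, split_expVec, opTensor_htmul, inner_htmul]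

theorem tensorAt_comp (t : ℝ≥0) (X X' : FockPast k t →L[ℂ] FockPast k t)
    (Y Y' : FockFuture k t →L[ℂ] FockFuture k t) :
    tensorAt t X Y ∘L tensorAt t X' Y' = tensorAt t (X ∘L X') (Y ∘L Y') := by
  rw [tensorAt, tensorAt, pullOp_comp, opTensor_comp, tensorAt]

theorem restr_Ico_congr {a b : ℝ≥0} (hab : a ≤ b) {f g : L2 k}
    (h : restr (Set.Ico 0 (b : ℝ)) f = restr (Set.Ico 0 (b : ℝ)) g) :
    restr (Set.Ico 0 (a : ℝ)) f = restr (Set.Ico 0 (a : ℝ)) g := by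
  have hsub : Set.Ico 0 (a : ℝ) ⊆ Set.Ico 0 (b : ℝ) := Set.Ico_subset_Ico_right (by exact_mod_cast hab)
  have hb : ∀ᵐ s ∂(halfLine.restrict (Set.Ico 0 (b : ℝ))), f s = g s := by
    filter_upwards [LpToLpRestrictCLM_coeFn ℂ (Set.Ico 0 (b : ℝ)) f,
      LpToLpRestrictCLM_coeFn ℂ (Set.Ico 0 (b : ℝ)) g] with s h1 h2
    rw [← h1, ← h2]
    exact congrArg (fun F : L2On k (Set.Ico 0 (b : ℝ)) => F s) h
  refine Lp.ext ?_
  filter_upwards [LpToLpRestrictCLM_coeFn ℂ (Set.Ico 0 (a : ℝ)) f,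
    LpToLpRestrictCLM_coeFn ℂ (Set.Ico 0 (a : ℝ)) g, ae_restrict_of_ae_restrict_of_subset hsub hb]
    with s h1 h2 h3
  rw [restr, h1, h2, h3]

/-- Extension by zero from `[0, t)`, at the level of Fock spaces. -/
theorem exists_extendPast (t : ℝ≥0) : ∃ (e : L2On k (Set.Ico 0 (t : ℝ)) → L2 k)
    (J : FockPast k t →ₗᵢ[ℂ] FockSpace k),
    (∀ f, restr (Set.Ico 0 (t : ℝ)) (e f) = f) ∧ (∀ f, restr (Set.Ici (t : ℝ)) (e f) = 0) ∧
      ∀ f, J (expVec f) = expVec (e f) := by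
  choose e he he' using fun f : L2On k (Set.Ico 0 (t : ℝ)) => exists_glue t f 0
  obtain ⟨J, hJ⟩ := exists_isometry (expVec : L2On k (Set.Ico 0 (t : ℝ)) → FockPast k t)
    (fun f => expVec (e f)) (fun f g => by
      rw [inner_expVec, inner_expVec, inner_eq_past_add_future t, he, he, he', inner_zero_left,
        add_zero]) span_expVec_dense
  exact ⟨e, J, he, he', hJ⟩

/-- An operator of the past at time `a` is an operator of the past at any later time `b`: it is
compressed to `𝓕_{b)}`, and its matrix elements on exponential vectors factorise at `b`. -/
theorem exists_tensorAt_eq_of_le {a b : ℝ≥0} (hab : a ≤ b)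
    (X : FockPast k a →L[ℂ] FockPast k a) :
    ∃ X' : FockPast k b →L[ℂ] FockPast k b, tensorAt a X 1 = tensorAt b X' 1 := by
  obtain ⟨e, J, he, he', hJ⟩ := exists_extendPast (k := k) b
  refine ⟨ContinuousLinearMap.adjoint J.toContinuousLinearMap ∘L tensorAt a X 1 ∘L
    J.toContinuousLinearMap, ?_⟩
  refine eq_of_inner_total span_expVec_dense span_expVec_dense fun f g => ?_
  rw [inner_tensorAt b, ContinuousLinearMap.comp_apply, ContinuousLinearMap.adjoint_inner_right,
    ContinuousLinearMap.comp_apply, LinearIsometry.coe_toContinuousLinearMap, hJ, hJ,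
    inner_tensorAt, inner_tensorAt, restr_Ico_congr hab (he _), restr_Ico_congr hab (he _),
    mul_assoc]
  congr 1
  simp only [one_apply_eq_self]
  rw [inner_expVec, inner_expVec, inner_expVec, ← Complex.exp_add]
  congr 1
  set f' := e (restr (Set.Ico 0 (b : ℝ)) f) with hf'
  set g' := e (restr (Set.Ico 0 (b : ℝ)) g) with hg'
  have h1 := inner_eq_past_add_future a f g
  have h2 := inner_eq_past_add_future b f g
  have h3 := inner_eq_past_add_future a f' g'
  have h4 := inner_eq_past_add_future b f' g'
  rw [hf', hg', he', inner_zero_left, add_zero, he, he, ← hf', ← hg'] at h4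
  rw [hf', hg', restr_Ico_congr hab (he _), restr_Ico_congr hab (he _), ← hf', ← hg'] at h3
  linear_combination h2 - h1 + h3 - h4

theorem tensorAt_sub (t : ℝ≥0) (X X' : FockPast k t →L[ℂ] FockPast k t) :
    tensorAt t (X - X') 1 = tensorAt t X 1 - tensorAt t X' 1 := by
  ext z
  simp [tensorAt, pullOp, sub_opTensor]

theorem tensorAt_zero (t : ℝ≥0) :
    tensorAt t (0 : FockPast k t →L[ℂ] FockPast k t) 1 = 0 := by
  rw [← sub_self (0 : FockPast k t →L[ℂ] FockPast k t), tensorAt_sub, sub_self]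

theorem QuantumStopTime.exists_proj_Icc_eq_tensorAt (S : QuantumStopTime k) (hS : S.proj {0} = 0)
    {a b : ℝ≥0} (hab : a ≤ b) :
    ∃ X : FockPast k b →L[ℂ] FockPast k b, S.proj (Set.Icc 0 (a : ℝ≥0∞)) = tensorAt b X 1 := by
  rcases eq_or_ne a 0 with rfl | ha
  · exact ⟨0, by simp [tensorAt_zero, hS]⟩
  · obtain ⟨X, hX⟩ := S.adapted a (pos_iff_ne_zero.2 ha)
    rw [hX]
    exact exists_tensorAt_eq_of_le hab X

theorem QuantumStopTime.exists_proj_Ioc_eq_tensorAt (S : QuantumStopTime k) (hS : S.proj {0} = 0)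
    {a b : ℝ≥0} (hab : a ≤ b) :
    ∃ X : FockPast k b →L[ℂ] FockPast k b,
      S.proj (Set.Ioc (a : ℝ≥0∞) b) = tensorAt b X 1 := by
  obtain ⟨X, hX⟩ := S.exists_proj_Icc_eq_tensorAt hS hab
  obtain ⟨Y, hY⟩ := S.exists_proj_Icc_eq_tensorAt hS (le_refl b)
  exact ⟨Y - X, by rw [S.proj_Ioc (by exact_mod_cast hab), hX, hY, tensorAt_sub]⟩

theorem ampl_tensorAt (t : ℝ≥0) (X : FockPast k t →L[ℂ] FockPast k t) :
    ampl h (tensorAt t X 1) =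
      pullOp (splitR t) (opTensor X (1 : HTensor h (FockFuture k t) →L[ℂ] _)) := by
  refine eq_of_inner_total span_htmul_expVec_dense span_htmul_expVec_dense
    fun (i : h × L2 k) j => ?_
  rw [inner_pullOp, splitR_htmul, splitR_htmul, opTensor_htmul, inner_htmul, ampl, opTensor_htmul,
    inner_htmul, inner_tensorAt]
  simp only [one_apply_eq_self, inner_htmul]
  ring

/-- Operators of the past commute with operators of the future. -/
theorem ampl_tensorAt_comm (t : ℝ≥0) (X : FockPast k t →L[ℂ] FockPast k t)
    (Y : HTensor h (FockFuture k t) →L[ℂ] HTensor h (FockFuture k t)) :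
    ampl h (tensorAt t X 1) ∘L pullOp (splitR t) (opTensor 1 Y) =
      pullOp (splitR t) (opTensor 1 Y) ∘L ampl h (tensorAt t X 1) := by
  rw [ampl_tensorAt, pullOp_comp, pullOp_comp, opTensor_comp, opTensor_comp]
  rfl

theorem norm_sq_mul_inner_pastFuture (t : ℝ≥0) (X : FockPast k t →L[ℂ] FockPast k t)
    (Y : HTensor h (FockFuture k t) →L[ℂ] HTensor h (FockFuture k t)) (u : h) (f : L2 k) :
    (‖htmul u (expVec f)‖ : ℂ) ^ 2 *
        ⟪ampl h (tensorAt t X 1) (htmul u (expVec f)),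
          pullOp (splitR t) (opTensor 1 Y) (ampl h (tensorAt t X 1) (htmul u (expVec f)))⟫_ℂ =
      (‖ampl h (tensorAt t X 1) (htmul u (expVec f))‖ : ℂ) ^ 2 *
        ⟪htmul u (expVec f), pullOp (splitR t) (opTensor 1 Y) (htmul u (expVec f))⟫_ℂ := by
  rw [ampl_tensorAt]
  exact norm_sq_mul_inner_of_eq_htmul (splitR t) X Y (splitR_htmul t u f)

/-! ### The time projections -/

theorem isStarProjection_secondQuantProj {H : Type*} [NormedAddCommGroup H]
    [InnerProductSpace ℂ H] (Q : H → H) : IsStarProjection (secondQuantProj Q) :=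
  isStarProjection_starProjection

theorem restr_truncate_past (t : ℝ≥0) (f : L2 k) :
    restr (Set.Ico 0 (t : ℝ)) (truncate t f) = restr (Set.Ico 0 (t : ℝ)) f := by
  refine Lp.ext ?_
  filter_upwards [LpToLpRestrictCLM_coeFn ℂ (Set.Ico 0 (t : ℝ)) f,
    LpToLpRestrictCLM_coeFn ℂ (Set.Ico 0 (t : ℝ)) (truncate t f),
    ae_restrict_of_ae (s := Set.Ico 0 (t : ℝ))
      ((Lp.memLp f).indicator (measurableSet_Ico (a := (0 : ℝ)) (b := (t : ℝ)))).coeFn_toLp,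
    ae_restrict_mem measurableSet_Ico] with s h1 h2 h3 h4
  rw [restr, h1, h2, truncate, h3, Set.indicator_of_mem h4]

theorem restr_truncate_future (t : ℝ≥0) (f : L2 k) :
    restr (Set.Ici (t : ℝ)) (truncate t f) = 0 := by
  refine Lp.ext ?_
  filter_upwards [LpToLpRestrictCLM_coeFn ℂ (Set.Ici (t : ℝ)) (truncate t f),
    ae_restrict_of_ae (s := Set.Ici (t : ℝ))
      ((Lp.memLp f).indicator (measurableSet_Ico (a := (0 : ℝ)) (b := (t : ℝ)))).coeFn_toLp,
    ae_restrict_mem measurableSet_Ici,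
    Lp.coeFn_zero k 2 (halfLine.restrict (Set.Ici (t : ℝ)))] with s h1 h2 h3 h4
  rw [restr, h1, truncate, h2, h4, Pi.zero_apply,
    Set.indicator_of_notMem (Set.disjoint_right.1 (past_disjoint_future t) h3)]

theorem inner_truncate_left (t : ℝ≥0) (f g : L2 k) :
    ⟪truncate t f, g⟫_ℂ =
      ⟪restr (Set.Ico 0 (t : ℝ)) f, restr (Set.Ico 0 (t : ℝ)) g⟫_ℂ := by
  rw [inner_eq_past_add_future t, restr_truncate_past, restr_truncate_future, inner_zero_left,
    add_zero]

theorem inner_truncate_truncate (t : ℝ≥0) (f g : L2 k) :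
    ⟪truncate t f, truncate t g⟫_ℂ = ⟪truncate t f, g⟫_ℂ := by
  rw [inner_truncate_left, inner_truncate_left, restr_truncate_past]

theorem timeProj_expVec (t : ℝ≥0) (f : L2 k) :
    timeProj (t : ℝ≥0∞) (expVec f) = expVec (truncate t f) := by
  rw [timeProj, if_neg ENNReal.coe_ne_top, ENNReal.toNNReal_coe,
    secondQuantProj_expVec _ (inner_truncate_truncate t)]

theorem timeProj_top : (timeProj ⊤ : FockSpace k →L[ℂ] FockSpace k) = 1 := if_pos rfl

theorem isStarProjection_timeProj (t : ℝ≥0∞) :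
    IsStarProjection (timeProj t : FockSpace k →L[ℂ] FockSpace k) := by
  rw [timeProj]
  split_ifs
  · exact .one _
  · exact isStarProjection_secondQuantProj _

theorem futureProj_zero_expVec (t : ℝ≥0) (f : L2On k (Set.Ici (t : ℝ))) :
    futureProj (0 : k →L[ℂ] k) t (expVec f) = expVec 0 := by
  have h0 : ∀ g : L2On k (Set.Ici (t : ℝ)),
      (0 : k →L[ℂ] k).compLpL 2 (halfLine.restrict (Set.Ici (t : ℝ))) g = 0 := by
    intro g
    refine Lp.ext ?_
    filter_upwards [(0 : k →L[ℂ] k).coeFn_compLpL g,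
      Lp.coeFn_zero k 2 (halfLine.restrict (Set.Ici (t : ℝ)))] with s h1 h2
    rw [h1, h2]
    rfl
  rw [futureProj, secondQuantProj_expVec _ (fun f g => by rw [h0, h0, inner_zero_left,
    inner_zero_left]), h0]

theorem futureProj_one (t : ℝ≥0) : futureProj (1 : k →L[ℂ] k) t = 1 := by
  have h1 : ∀ g : L2On k (Set.Ici (t : ℝ)),
      (1 : k →L[ℂ] k).compLpL 2 (halfLine.restrict (Set.Ici (t : ℝ))) g = g := by
    intro g
    refine Lp.ext ?_
    filter_upwards [(1 : k →L[ℂ] k).coeFn_compLpL g] with s h1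
    rw [h1]
    rfl
  refine ContinuousLinearMap.ext_on span_expVec_dense ?_
  rintro _ ⟨f, rfl⟩
  rw [futureProj, secondQuantProj_expVec _ (fun f g => by rw [h1, h1]), h1]
  rfl

theorem timeProj_eq_tensorAt (t : ℝ≥0) :
    (timeProj (t : ℝ≥0∞) : FockSpace k →L[ℂ] FockSpace k) =
      tensorAt t 1 (futureProj (0 : k →L[ℂ] k) t) := by
  refine eq_of_inner_total span_expVec_dense span_expVec_dense fun f g => ?_
  rw [timeProj_expVec, inner_tensorAt, futureProj_zero_expVec, inner_expVec_split t,
    restr_truncate_past, restr_truncate_future]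
  rfl

theorem timeProj_mul_of_le {s t : ℝ≥0∞} (hst : s ≤ t) :
    (timeProj t * timeProj s : FockSpace k →L[ℂ] FockSpace k) = timeProj s := by
  rcases eq_or_ne t ⊤ with rfl | ht
  · rw [timeProj_top, one_mul]
  lift t to ℝ≥0 using ht
  lift s to ℝ≥0 using ne_top_of_le_ne_top ENNReal.coe_ne_top hst
  replace hst : s ≤ t := by exact_mod_cast hst
  have htrunc : ∀ f : L2 k, truncate s (truncate t f) = truncate s f := fun f =>
    ext_inner_right ℂ fun g => by
      rw [inner_truncate_left, inner_truncate_left, restr_Ico_congr hst (restr_truncate_past t f)]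
  have h1 : (timeProj (s : ℝ≥0∞) * timeProj (t : ℝ≥0∞) : FockSpace k →L[ℂ] FockSpace k) =
      timeProj (s : ℝ≥0∞) := by
    refine ContinuousLinearMap.ext_on span_expVec_dense ?_
    rintro _ ⟨f, rfl⟩
    rw [mul_apply_eq_comp, timeProj_expVec, timeProj_expVec, timeProj_expVec, htrunc]
  have h2 := congrArg star h1
  rwa [star_mul, (isStarProjection_timeProj _).isSelfAdjoint.star_eq,
    (isStarProjection_timeProj _).isSelfAdjoint.star_eq] at h2

/-- `S([0, a])` belongs to the past and `E_b` to the future of any `b ≥ a`, so they commute. -/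
theorem QuantumStopTime.proj_Icc_timeProj_comm (S : QuantumStopTime k) (hS : S.proj {0} = 0)
    {a b : ℝ≥0∞} (hab : a ≤ b) :
    S.proj (Set.Icc 0 a) * timeProj b = timeProj b * S.proj (Set.Icc 0 a) := by
  rcases eq_or_ne b ⊤ with rfl | hb
  · rw [timeProj_top, one_mul, mul_one]
  lift b to ℝ≥0 using hb
  lift a to ℝ≥0 using ne_top_of_le_ne_top ENNReal.coe_ne_top hab
  obtain ⟨X, hX⟩ := S.exists_proj_Icc_eq_tensorAt hS (a := a) (b := b) (by exact_mod_cast hab)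
  rw [hX, timeProj_eq_tensorAt]
  change _ ∘L _ = _ ∘L _
  rw [tensorAt_comp, tensorAt_comp]
  rfl

theorem QuantumStopTime.proj_Ioc_timeProj_comm (S : QuantumStopTime k) (hS : S.proj {0} = 0)
    {a b : ℝ≥0∞} (hab : a ≤ b) :
    S.proj (Set.Ioc a b) * timeProj b = timeProj b * S.proj (Set.Ioc a b) := by
  rw [S.proj_Ioc hab, sub_mul, mul_sub, S.proj_Icc_timeProj_comm hS hab,
    S.proj_Icc_timeProj_comm hS le_rfl]

end Adapted


/-! ### Strong limits -/

section StrongLim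

variable {ι E : Type*} [NormedAddCommGroup E] [InnerProductSpace ℂ E]

theorem HasStrongLim.strongLim {l : Filter ι} {T : ι → E →L[ℂ] E}
    (h : ∃ W, HasStrongLim l T W) : HasStrongLim l T (strongLim l T) := by
  rw [StopCCR.strongLim, dif_pos h]
  exact h.choose_spec

theorem HasStrongLim.unique {l : Filter ι} [l.NeBot] {T : ι → E →L[ℂ] E} {W W' : E →L[ℂ] E}
    (h : HasStrongLim l T W) (h' : HasStrongLim l T W') : W = W' :=
  ContinuousLinearMap.ext fun z => tendsto_nhds_unique (h z) (h' z)

theorem norm_sq_sum_of_orthogonal (s : Finset ι) (v : ι → E)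
    (hv : ∀ i ∈ s, ∀ j ∈ s, i ≠ j → ⟪v i, v j⟫_ℂ = 0) :
    ‖∑ i ∈ s, v i‖ ^ 2 = ∑ i ∈ s, ‖v i‖ ^ 2 := by
  have h : ((‖∑ i ∈ s, v i‖ ^ 2 : ℝ) : ℂ) = ((∑ i ∈ s, ‖v i‖ ^ 2 : ℝ) : ℂ) := by
    push_cast
    have hn : ∀ x : E, (‖x‖ : ℂ) ^ 2 = ⟪x, x⟫_ℂ := fun x => (inner_self_eq_norm_sq_to_K x).symm
    rw [hn, sum_inner]
    refine Finset.sum_congr rfl fun i hi => ?_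
    rw [inner_sum, Finset.sum_eq_single_of_mem i hi fun j hj hne => hv i hi j hj hne.symm, hn]
  exact_mod_cast h

theorem exists_hasStrongLim_of_cauchySeq [CompleteSpace E] [Preorder ι] [IsDirectedOrder ι]
    [Nonempty ι] (T : ι → E →L[ℂ] E) (hT : ∀ i z, ‖T i z‖ ≤ ‖z‖)
    (hc : ∀ z, CauchySeq fun i => T i z) : ∃ W, HasStrongLim atTop T W := by
  choose w hw using fun z => cauchySeq_tendsto_of_complete (hc z)
  have hb : Bornology.IsBounded (Set.range T) := by
    refine (Metric.isBounded_closedBall (x := (0 : E →L[ℂ] E)) (r := 1)).subset ?_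
    rintro _ ⟨i, rfl⟩
    rw [mem_closedBall_zero_iff]
    exact ContinuousLinearMap.opNorm_le_bound _ zero_le_one fun z => by simpa using hT i z
  exact ⟨ContinuousLinearMap.ofTendstoOfBoundedRange w T (tendsto_pi_nhds.2 hw) hb, hw⟩

/-- A net of contractions converges strongly once it does so on a total set. -/
theorem exists_hasStrongLim_of_total [CompleteSpace E] [SemilatticeSup ι] [Nonempty ι] {κ : Type*}
    (T : ι → E →L[ℂ] E) (hT : ∀ i z, ‖T i z‖ ≤ ‖z‖) {a : κ → E}
    (ha : Dense (Submodule.span ℂ (Set.range a) : Set E))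
    (hc : ∀ j, CauchySeq fun i => T i (a j)) : ∃ W, HasStrongLim atTop T W := by
  refine exists_hasStrongLim_of_cauchySeq T hT fun z => ?_
  have hspan : ∀ y ∈ Submodule.span ℂ (Set.range a), CauchySeq fun i => T i y := by
    intro y hy
    induction hy using Submodule.span_induction with
    | mem y hy =>
      obtain ⟨j, rfl⟩ := hy
      exact hc j
    | zero => simpa using cauchySeq_const (0 : E)
    | add y y' _ _ h h' =>
      simp only [map_add]
      exact h.add h'
    | smul c y _ h =>
      obtain ⟨w, hw⟩ := cauchySeq_tendsto_of_complete h
      simpa using (hw.const_smul c).cauchySeq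
  refine Metric.cauchySeq_iff'.2 fun ε hε => ?_
  obtain ⟨y, hy, hzy⟩ := Metric.dense_iff.1 ha z (ε / 3) (by positivity)
  obtain ⟨N, hN⟩ := Metric.cauchySeq_iff'.1 (hspan y hzy) (ε / 3) (by positivity)
  refine ⟨N, fun n hn => ?_⟩
  have hclose : ∀ i, dist (T i z) (T i y) < ε / 3 := fun i => by
    rw [dist_eq_norm, ← map_sub]
    refine (hT i _).trans_lt ?_
    rwa [← dist_eq_norm, dist_comm]
  calc dist (T n z) (T N z)
      ≤ dist (T n z) (T n y) + dist (T n y) (T N y) + dist (T N y) (T N z) :=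
        dist_triangle4 _ _ _ _
    _ < ε / 3 + ε / 3 + ε / 3 := by
        have := hclose N
        rw [dist_comm] at this
        linarith [hclose n, hN n hn]
    _ = ε := by ring

theorem norm_apply_le_of_isStarProjection [CompleteSpace E] {P : E →L[ℂ] E}
    (hP : IsStarProjection P) (z : E) : ‖P z‖ ≤ ‖z‖ :=
  (P.le_of_opNorm_le hP.norm_le z).trans_eq (one_mul _)

theorem inner_apply_of_isStarProjection [CompleteSpace E] {P : E →L[ℂ] E}
    (hP : IsStarProjection P) (x y : E) : ⟪P x, y⟫_ℂ = ⟪x, P y⟫_ℂ := by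
  rw [← ContinuousLinearMap.adjoint_inner_right]
  congr 2
  exact hP.isSelfAdjoint.star_eq

theorem inner_self_apply_of_isStarProjection [CompleteSpace E] {P : E →L[ℂ] E}
    (hP : IsStarProjection P) (z : E) : ⟪z, P z⟫_ℂ = (‖P z‖ : ℂ) ^ 2 := by
  have h : ⟪P z, P z⟫_ℂ = (‖P z‖ : ℂ) ^ 2 := inner_self_eq_norm_sq_to_K _
  rw [← h, inner_apply_of_isStarProjection hP, ← mul_apply_eq_comp, hP.isIdempotentElem]

theorem norm_sq_sub_of_isStarProjection [CompleteSpace E] {P : E →L[ℂ] E}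
    (hP : IsStarProjection P) (z : E) : ‖z - P z‖ ^ 2 = ‖z‖ ^ 2 - ‖P z‖ ^ 2 := by
  rw [@norm_sub_sq ℂ, inner_self_apply_of_isStarProjection hP]
  have : RCLike.re ((‖P z‖ : ℂ) ^ 2) = ‖P z‖ ^ 2 := by
    rw [← Complex.ofReal_pow]
    exact Complex.ofReal_re _
  rw [this]
  ring

/-- A decreasing net of orthogonal projections converges strongly. -/
theorem exists_hasStrongLim_of_antitone [CompleteSpace E] [SemilatticeSup ι] [Nonempty ι]
    (T : ι → E →L[ℂ] E) (hT : ∀ i, IsStarProjection (T i))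
    (hle : ∀ i j, i ≤ j → T j * T i = T j) : ∃ W, HasStrongLim atTop T W := by
  refine exists_hasStrongLim_of_cauchySeq T (fun i => norm_apply_le_of_isStarProjection (hT i))
    fun z => Metric.cauchySeq_iff'.2 fun ε hε => ?_
  have hbdd : BddBelow (Set.range fun i => ‖T i z‖ ^ 2) :=
    ⟨0, by rintro _ ⟨i, rfl⟩; positivity⟩
  obtain ⟨N, hN⟩ := exists_lt_of_ciInf_lt
    (lt_add_of_pos_right (⨅ i, ‖T i z‖ ^ 2) (pow_pos hε 2))
  refine ⟨N, fun n hn => ?_⟩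
  have h1 : T n (T N z) = T n z := by rw [← mul_apply_eq_comp, hle N n hn]
  have h2 := norm_sq_sub_of_isStarProjection (hT n) (T N z)
  rw [h1] at h2
  have h3 : (⨅ i, ‖T i z‖ ^ 2) ≤ ‖T n z‖ ^ 2 := ciInf_le hbdd n
  rw [dist_comm, dist_eq_norm]
  refine lt_of_pow_lt_pow_left₀ 2 hε.le ?_
  linarith

end StrongLim

/-! ### Ampliations -/

section Ampliation

variable {k : Type*} [NormedAddCommGroup k] [InnerProductSpace ℂ k]
  {h : Type*} [NormedAddCommGroup h] [InnerProductSpace ℂ h]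

theorem ampl_mul (X Y : FockSpace k →L[ℂ] FockSpace k) :
    ampl h (X * Y) = ampl h X * ampl h Y := by
  change ampl h (X ∘L Y) = ampl h X ∘L ampl h Y
  rw [ampl, ampl, ampl, opTensor_comp]
  rfl

variable (h) in
/-- The ampliation `X ↦ I_h ⊗ X` as an additive map. -/
noncomputable def amplHom : (FockSpace k →L[ℂ] FockSpace k) →+
    (HTensor h (FockSpace k) →L[ℂ] HTensor h (FockSpace k)) :=
  AddMonoidHom.mk' (ampl h) fun X Y => opTensor_add 1 X Y

theorem ampl_zero : ampl h (0 : FockSpace k →L[ℂ] FockSpace k) = 0 :=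
  map_zero (amplHom h)

theorem ampl_sum {ι : Type*} (s : Finset ι) (X : ι → FockSpace k →L[ℂ] FockSpace k) :
    ampl h (∑ i ∈ s, X i) = ∑ i ∈ s, ampl h (X i) :=
  map_sum (amplHom h) X s

theorem ampl_one : ampl h (1 : FockSpace k →L[ℂ] FockSpace k) = 1 :=
  opTensor_one_one

variable [CompleteSpace h]

theorem isStarProjection_ampl {X : FockSpace k →L[ℂ] FockSpace k} (hX : IsStarProjection X) :
    IsStarProjection (ampl h X) := by
  refine ⟨?_, ?_⟩
  · change ampl h X * ampl h X = ampl h X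
    rw [← ampl_mul, hX.isIdempotentElem]
  · change ContinuousLinearMap.adjoint (ampl h X) = ampl h X
    have h1 : ContinuousLinearMap.adjoint X = X := hX.isSelfAdjoint
    rw [ampl, adjoint_opTensor, h1, ← ContinuousLinearMap.star_eq_adjoint, star_one]

theorem hasStrongLim_ampl {ι : Type*} [SemilatticeSup ι] [Nonempty ι]
    {T : ι → FockSpace k →L[ℂ] FockSpace k} {W : FockSpace k →L[ℂ] FockSpace k}
    (hT : ∀ i, IsStarProjection (T i)) (hW : HasStrongLim atTop T W) :
    HasStrongLim atTop (fun i => ampl h (T i)) (ampl h W) := by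
  have hlim : ∀ p : h × FockSpace k,
      Tendsto (fun i => ampl h (T i) (htmul p.1 p.2)) atTop (𝓝 (ampl h W (htmul p.1 p.2))) := by
    rintro ⟨x, y⟩
    simp only [ampl, opTensor_htmul]
    rw [tendsto_iff_norm_sub_tendsto_zero]
    have := ((tendsto_iff_norm_sub_tendsto_zero.1 (hW y)).const_mul ‖x‖)
    simpa [← htmul_sub, norm_htmul] using this
  obtain ⟨W', hW'⟩ := exists_hasStrongLim_of_total (fun i => ampl h (T i))
    (fun i => norm_apply_le_of_isStarProjection (isStarProjection_ampl (hT i)))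
    span_htmul_id_dense fun p => (hlim p).cauchySeq
  have : W' = ampl h W := by
    refine ContinuousLinearMap.ext_on span_htmul_id_dense ?_
    rintro _ ⟨p, rfl⟩
    exact tendsto_nhds_unique (hW' _) (hlim p)
  exact this ▸ hW'

end Ampliation

/-! ### The time projections of a stop time -/

section StoppedTimeProj

variable {k : Type*} [NormedAddCommGroup k] [InnerProductSpace ℂ k] {t : ℝ≥0∞}

theorem timeProj_mul_of_le' {s t : ℝ≥0∞} (hst : s ≤ t) :
    (timeProj s * timeProj t : FockSpace k →L[ℂ] FockSpace k) = timeProj s := by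
  have h := congrArg star (timeProj_mul_of_le (k := k) hst)
  rwa [star_mul, (isStarProjection_timeProj _).isSelfAdjoint.star_eq,
    (isStarProjection_timeProj _).isSelfAdjoint.star_eq] at h

/-- The summand `X ↦ X E_s` of `E_{S,π}`. -/
noncomputable def timeProjHom (s : ℝ≥0∞) :
    (FockSpace k →L[ℂ] FockSpace k) →+ (FockSpace k →L[ℂ] FockSpace k) :=
  AddMonoidHom.mulRight (timeProj s)

theorem timeProjSum_eq_spectralSum (S : QuantumStopTime k) (π : TimePartition t) :
    timeProjSum S π = spectralSum S timeProjHom π := rfl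

theorem TimePartition.proj_mul_proj (S : QuantumStopTime k) (π : TimePartition t)
    {s s' : ℝ≥0∞} (hs : s ∈ π.1.erase 0) (hs' : s' ∈ π.1.erase 0) (hne : s ≠ s') :
    S.proj (Set.Ioc (π.pred s) s) * S.proj (Set.Ioc (π.pred s') s') = 0 :=
  S.proj_mul_of_disjoint measurableSet_Ioc measurableSet_Ioc (π.pairwiseDisjoint_Ioc_pred
    (Finset.mem_of_mem_erase hs) (Finset.mem_of_mem_erase hs') hne)

theorem TimePartition.pred_le (π : TimePartition t) {s : ℝ≥0∞} (hs : s ∈ π.1.erase 0) :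
    π.pred s ≤ s :=
  (π.pred_lt (pos_iff_ne_zero.2 (Finset.ne_of_mem_erase hs))).le

/-- Refinement makes `E_{S,π}` smaller, as `E_s ≤ E_{s'}` for `s ≤ s'`. -/
theorem timeProjSum_mul_of_le (S : QuantumStopTime k) (hS : S.proj {0} = 0)
    {π π' : TimePartition t} (hle : π ≤ π') :
    timeProjSum S π' * timeProjSum S π = timeProjSum S π' := by
  rw [timeProjSum_eq_spectralSum S π, spectralSum_eq_of_le S _ hle, timeProjSum,
    Finset.sum_mul_sum]
  refine Finset.sum_congr rfl fun s hs => ?_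
  have hc := S.proj_Ioc_timeProj_comm hS (π'.pred_le hs)
  rw [Finset.sum_eq_single_of_mem s hs]
  · change S.proj (Set.Ioc (π'.pred s) s) * timeProj s *
      (S.proj (Set.Ioc (π'.pred s) s) * timeProj (π.next s)) =
      S.proj (Set.Ioc (π'.pred s) s) * timeProj s
    rw [mul_assoc, ← mul_assoc (timeProj s), ← hc, mul_assoc, timeProj_mul_of_le' (π.le_next s),
      ← mul_assoc, S.proj_mul_self measurableSet_Ioc]
  · intro s' hs' hne
    change S.proj (Set.Ioc (π'.pred s) s) * timeProj s *
      (S.proj (Set.Ioc (π'.pred s') s') * timeProj (π.next s')) = 0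
    rw [hc, mul_assoc, ← mul_assoc (S.proj _), π'.proj_mul_proj S hs hs' hne.symm, zero_mul,
      mul_zero]

theorem isStarProjection_timeProjSum (S : QuantumStopTime k) (hS : S.proj {0} = 0)
    (π : TimePartition t) : IsStarProjection (timeProjSum S π) := by
  refine ⟨timeProjSum_mul_of_le S hS le_rfl, ?_⟩
  have hsum : timeProjSum S π =
      ∑ s ∈ π.1.erase 0, S.proj (Set.Ioc (π.pred s) s) * timeProj s := rfl
  rw [hsum]
  refine isSelfAdjoint_sum _ fun s hs => ?_
  exact ((S.isStarProjection _ measurableSet_Ioc).isSelfAdjoint.commute_iff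
    (isStarProjection_timeProj s).isSelfAdjoint).1 (S.proj_Ioc_timeProj_comm hS (π.pred_le hs))

theorem hasStrongLim_timeProjSum (S : QuantumStopTime k) (hS : S.proj {0} = 0) (t : ℝ≥0∞) :
    HasStrongLim atTop (fun π : TimePartition t => timeProjSum S π) (stoppedTimeProj S t) :=
  .strongLim (exists_hasStrongLim_of_antitone _ (isStarProjection_timeProjSum S hS)
    fun _ _ hle => timeProjSum_mul_of_le S hS hle)

/-- `S([0, r]) E_{S,t} = E_{S,r}` for `r ≤ t`, which reduces the behaviour of `E_{S,r}` as `r → ∞` to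
that of `S([0, r])`. -/
theorem proj_Icc_mul_stoppedTimeProj (S : QuantumStopTime k) (hS : S.proj {0} = 0)
    {r t : ℝ≥0∞} (hr : r ≤ t) :
    S.proj (Set.Icc 0 r) * stoppedTimeProj S t = stoppedTimeProj S r := by
  refine HasStrongLim.unique (l := atTop) (T := fun π : TimePartition t =>
    timeProjSum S (π.restrict r)) (fun z => ?_)
    fun z => (hasStrongLim_timeProjSum S hS r z).comp (TimePartition.tendsto_restrict hr)
  have h1 := ((S.proj (Set.Icc 0 r)).continuous.tendsto _).comp (hasStrongLim_timeProjSum S hS t z)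
  refine h1.congr' ?_
  filter_upwards [TimePartition.eventually_mem hr] with π hπ
  rw [timeProjSum_eq_spectralSum, spectralSum_restrict S _ hπ]
  change (S.proj (Set.Icc 0 r) * timeProjSum S π) z = _
  rw [timeProjSum, Finset.mul_sum]
  congr 1

/-- As `S({∞}) = 0`, the projections `S([0, r])` increase to the identity. -/
theorem hasStrongLim_proj_Icc (S : QuantumStopTime k) (hS : S.proj {⊤} = 0) :
    HasStrongLim atTop (fun r : ℝ≥0 => S.proj (Set.Icc 0 (r : ℝ≥0∞))) 1 := by
  have huniv : S.proj (Set.Iio ⊤) = 1 := by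
    rw [← S.proj_univ, ← Set.Iio_union_Ici (a := (⊤ : ℝ≥0∞)), Set.Ici_top,
      S.proj_union measurableSet_Iio (measurableSet_singleton _) (by simp), hS, add_zero]
  have hU : ⋃ n : ℕ, Set.Icc (0 : ℝ≥0∞) (n : ℝ≥0∞) = Set.Iio ⊤ := by
    ext x
    simp only [Set.mem_iUnion, Set.mem_Icc, zero_le, true_and, Set.mem_Iio]
    constructor
    · rintro ⟨n, hn⟩
      exact hn.trans_lt (ENNReal.natCast_lt_top n)
    · intro hx
      obtain ⟨n, hn⟩ := ENNReal.exists_nat_gt hx.ne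
      exact ⟨n, hn.le⟩
  intro z
  have hP : ∀ r : ℝ≥0∞, IsStarProjection (S.proj (Set.Icc 0 r)) := fun r =>
    S.isStarProjection _ measurableSet_Icc
  -- Countable additivity gives the limit along the integers, and monotonicity the rest.
  have hlim : Tendsto (fun n : ℕ => ‖S.proj (Set.Icc 0 (n : ℝ≥0∞)) z‖ ^ 2) atTop
      (𝓝 (‖z‖ ^ 2)) := by
    obtain ⟨m, hm⟩ := S.isMeasure z z
    have h1 := VectorMeasure.tendsto_vectorMeasure_iUnion_atTop_nat (v := m)
      (s := fun n : ℕ => Set.Icc (0 : ℝ≥0∞) (n : ℝ≥0∞))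
      (fun a b hab => Set.Icc_subset_Icc_right (by exact_mod_cast hab))
      (fun _ => measurableSet_Icc)
    rw [hU, hm _ measurableSet_Iio, huniv] at h1
    have h2 := (Complex.continuous_re.tendsto _).comp h1
    rw [one_apply_eq_self, inner_self_eq_norm_sq_to_K] at h2
    convert h2 using 2
    · rename_i n
      simp only [Function.comp_apply, hm _ measurableSet_Icc,
        inner_self_apply_of_isStarProjection (hP _)]
      rw [← Complex.ofReal_pow, Complex.ofReal_re]
    · change _ = Complex.re ((‖z‖ : ℂ) ^ 2)
      rw [← Complex.ofReal_pow, Complex.ofReal_re]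
  rw [one_apply_eq_self, Metric.tendsto_atTop]
  intro ε hε
  have hev := hlim.eventually (lt_mem_nhds (show ‖z‖ ^ 2 - ε ^ 2 < ‖z‖ ^ 2 by
    linarith [pow_pos hε 2]))
  obtain ⟨n, hn⟩ := hev.exists
  refine ⟨n, fun r hr => ?_⟩
  have hnr : (n : ℝ≥0∞) ≤ r := by exact_mod_cast hr
  have hmul := S.proj_mul_of_subset (measurableSet_Icc (a := (0 : ℝ≥0∞)) (b := n))
    (measurableSet_Icc (a := (0 : ℝ≥0∞)) (b := r)) (Set.Icc_subset_Icc_right hnr)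
  have hstar := congrArg star hmul
  rw [star_mul, (hP _).isSelfAdjoint.star_eq, (hP _).isSelfAdjoint.star_eq] at hstar
  have hmono : ‖S.proj (Set.Icc 0 (n : ℝ≥0∞)) z‖ ≤ ‖S.proj (Set.Icc 0 (r : ℝ≥0∞)) z‖ := by
    rw [← hstar, mul_apply_eq_comp]
    exact norm_apply_le_of_isStarProjection (hP _) _
  have hsq := pow_le_pow_left₀ (norm_nonneg _) hmono 2
  rw [dist_comm, dist_eq_norm]
  refine lt_of_pow_lt_pow_left₀ 2 hε.le ?_
  rw [norm_sq_sub_of_isStarProjection (hP _)]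
  linarith

end StoppedTimeProj


/-! ### Isometric cocycles -/

section CocycleTensor

variable {k : Type*} [NormedAddCommGroup k] [InnerProductSpace ℂ k]
  {h : Type*} [NormedAddCommGroup h] [InnerProductSpace ℂ h]

theorem tensorAtL_comp (t : ℝ≥0) (X X' : HTensor h (FockPast k t) →L[ℂ] HTensor h (FockPast k t))
    (Y Y' : FockFuture k t →L[ℂ] FockFuture k t) :
    tensorAtL t X Y ∘L tensorAtL t X' Y' = tensorAtL t (X ∘L X') (Y ∘L Y') := by
  rw [tensorAtL, tensorAtL, pullOp_comp, opTensor_comp, tensorAtL]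

theorem adjoint_tensorAtL [CompleteSpace h] (t : ℝ≥0) (X : HTensor h (FockPast k t) →L[ℂ] HTensor h (FockPast k t))
    (Y : FockFuture k t →L[ℂ] FockFuture k t) :
    ContinuousLinearMap.adjoint (tensorAtL t X Y) =
      tensorAtL t (ContinuousLinearMap.adjoint X) (ContinuousLinearMap.adjoint Y) := by
  rw [tensorAtL, adjoint_pullOp, adjoint_opTensor, tensorAtL]

theorem pullOp_one {E F : Type*} [NormedAddCommGroup E] [InnerProductSpace ℂ E]
    [NormedAddCommGroup F] [InnerProductSpace ℂ F] (U : E ≃ₗᵢ[ℂ] F) : pullOp U 1 = 1 := by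
  ext z
  exact U.symm_apply_apply z

theorem tensorAtL_one_one (t : ℝ≥0) :
    tensorAtL t (1 : HTensor h (FockPast k t) →L[ℂ] HTensor h (FockPast k t)) 1 = 1 := by
  rw [tensorAtL, opTensor_one_one, pullOp_one]

/-- For `p = 0` the operator `P_{[t}` is the vacuum projection of `𝓕_{[t}`, and `1 ⊗ P_{[t} = E_t`. -/
theorem tensorAtL_futureProj_zero (t : ℝ≥0) :
    tensorAtL t (1 : HTensor h (FockPast k t) →L[ℂ] HTensor h (FockPast k t))
      (futureProj (0 : k →L[ℂ] k) t) = ampl h (timeProj (t : ℝ≥0∞)) := by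
  refine eq_of_inner_total span_htmul_expVec_dense span_htmul_expVec_dense
    fun (i : h × L2 k) j => ?_
  rw [tensorAtL, inner_pullOp, splitL_htmul, splitL_htmul, opTensor_htmul, inner_htmul, ampl,
    opTensor_htmul, inner_htmul, timeProj_eq_tensorAt, inner_tensorAt]
  simp only [one_apply_eq_self, inner_htmul]
  ring

end CocycleTensor

section Cocycle

variable {k : Type*} [NormedAddCommGroup k] [InnerProductSpace ℂ k]
  {h : Type*} [NormedAddCommGroup h] [InnerProductSpace ℂ h] [CompleteSpace h]
  {𝒜 : VonNeumannAlgebra h} {p : k →L[ℂ] k}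
  {V : ℝ≥0 → HTensor h (FockSpace k) →L[ℂ] HTensor h (FockSpace k)}

theorem IsIsometricCocycle.adjoint_comp_self (hV : IsIsometricCocycle 𝒜 p V) (t : ℝ≥0) :
    ContinuousLinearMap.adjoint (V t) ∘L V t = tensorAtL t 1 (futureProj p t) := by
  obtain ⟨Vp, hA, -, hiso⟩ := hV
  have hP : IsStarProjection (futureProj p t) := isStarProjection_secondQuantProj _
  have h1 : ContinuousLinearMap.adjoint (futureProj p t) = futureProj p t := hP.isSelfAdjoint
  have h2 : futureProj p t ∘L futureProj p t = futureProj p t := hP.isIdempotentElem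
  rw [hA.eq_tensor, adjoint_tensorAtL, tensorAtL_comp, hiso, h1, h2]

/-- `V_t` is a partial isometry with initial projection `1 ⊗ P_{[t}`. -/
theorem IsIsometricCocycle.isStarProjection (hV : IsIsometricCocycle 𝒜 p V) (t : ℝ≥0) :
    IsStarProjection (ContinuousLinearMap.adjoint (V t) ∘L V t) := by
  have hP : IsStarProjection (futureProj p t) := isStarProjection_secondQuantProj _
  have h1 : ContinuousLinearMap.adjoint (futureProj p t) = futureProj p t := hP.isSelfAdjoint
  have h2 : futureProj p t ∘L futureProj p t = futureProj p t := hP.isIdempotentElem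
  rw [hV.adjoint_comp_self]
  refine ⟨?_, ?_⟩
  · change _ ∘L _ = _
    rw [tensorAtL_comp, h2]
    rfl
  · change ContinuousLinearMap.adjoint _ = _
    rw [adjoint_tensorAtL, h1, ← ContinuousLinearMap.star_eq_adjoint, star_one]

theorem IsIsometricCocycle.norm_sq_apply (hV : IsIsometricCocycle 𝒜 p V) (t : ℝ≥0)
    (z : HTensor h (FockSpace k)) :
    ‖V t z‖ ^ 2 = ‖(ContinuousLinearMap.adjoint (V t) ∘L V t) z‖ ^ 2 := by
  have h1 := inner_self_apply_of_isStarProjection (hV.isStarProjection t) z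
  have h2 : ⟪V t z, V t z⟫_ℂ = (‖V t z‖ : ℂ) ^ 2 := inner_self_eq_norm_sq_to_K _
  rw [ContinuousLinearMap.comp_apply, ContinuousLinearMap.adjoint_inner_right, h2] at h1
  exact_mod_cast h1

theorem IsIsometricCocycle.norm_apply_le (hV : IsIsometricCocycle 𝒜 p V) (t : ℝ≥0)
    (z : HTensor h (FockSpace k)) : ‖V t z‖ ≤ ‖z‖ := by
  refine le_of_pow_le_pow_left₀ two_ne_zero (norm_nonneg _) ?_
  rw [hV.norm_sq_apply]
  exact pow_le_pow_left₀ (norm_nonneg _)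
    (norm_apply_le_of_isStarProjection (hV.isStarProjection t) z) 2

/-- By the cocycle identity `V_r = (V_{b)} ⊗ 1) σ_b(V_{r-b})` for `r ≥ b`, and `V_{b)}` is isometric,
so `V_r^* V_s = σ_b(V_{r-b})^* σ_b(V_{s-b})` belongs to the future of `b`. -/
theorem IsIsometricCocycle.exists_adjoint_comp_eq (hV : IsIsometricCocycle 𝒜 p V) {b r s : ℝ≥0}
    (hr : b ≤ r) (hs : b ≤ s) :
    ∃ Y : HTensor h (FockFuture k b) →L[ℂ] HTensor h (FockFuture k b),
      ContinuousLinearMap.adjoint (V r) ∘L V s = pullOp (splitR b) (opTensor 1 Y) := by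
  obtain ⟨Vp, hA, hcoc, hiso⟩ := hV
  have hfac : ∀ r, b ≤ r → ∃ Z : HTensor h (FockFuture k b) →L[ℂ] HTensor h (FockFuture k b),
      V r = tensorAtL b (Vp b) 1 ∘L pullOp (splitR b) (opTensor 1 Z) := fun r hr => by
    have hc := hcoc b (r - b)
    rw [add_tsub_cancel_of_le hr, ccrFlow] at hc
    exact ⟨_, hc⟩
  obtain ⟨Z, hZ⟩ := hfac r hr
  obtain ⟨Z', hZ'⟩ := hfac s hs
  refine ⟨ContinuousLinearMap.adjoint Z ∘L Z', ?_⟩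
  have hone : ∀ t : ℝ≥0, ContinuousLinearMap.adjoint (1 : FockFuture k t →L[ℂ] FockFuture k t) = 1 :=
    fun t => by rw [← ContinuousLinearMap.star_eq_adjoint, star_one]
  have hone' : ContinuousLinearMap.adjoint (1 : FockPast k b →L[ℂ] FockPast k b) = 1 := by
    rw [← ContinuousLinearMap.star_eq_adjoint, star_one]
  have hW : ContinuousLinearMap.adjoint (tensorAtL b (Vp b) 1) ∘L tensorAtL b (Vp b) 1 = 1 := by
    rw [adjoint_tensorAtL, tensorAtL_comp, hiso, hone]
    exact tensorAtL_one_one b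
  have hid : ∀ T : HTensor h (FockSpace k) →L[ℂ] HTensor h (FockSpace k),
      (1 : HTensor h (FockSpace k) →L[ℂ] HTensor h (FockSpace k)) ∘L T = T := fun T => one_mul T
  rw [hZ, hZ', ContinuousLinearMap.adjoint_comp, ContinuousLinearMap.comp_assoc,
    ← ContinuousLinearMap.comp_assoc (ContinuousLinearMap.adjoint (tensorAtL b (Vp b) 1)), hW,
    hid, adjoint_pullOp, adjoint_opTensor, hone', pullOp_comp, opTensor_comp]
  rfl

end Cocycle


/-! ### Stopped cocycles -/

section CocycleSum

variable {k : Type*} [NormedAddCommGroup k] [InnerProductSpace ℂ k]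
  {h : Type*} [NormedAddCommGroup h] [InnerProductSpace ℂ h]
  {V : ℝ≥0 → HTensor h (FockSpace k) →L[ℂ] HTensor h (FockSpace k)}

/-- The summand `X ↦ V_s (I ⊗ X)` of `V_{S,π}`. -/
noncomputable def cocycleHom (V : ℝ≥0 → HTensor h (FockSpace k) →L[ℂ] HTensor h (FockSpace k))
    (s : ℝ≥0∞) : (FockSpace k →L[ℂ] FockSpace k) →+
      (HTensor h (FockSpace k) →L[ℂ] HTensor h (FockSpace k)) :=
  (AddMonoidHom.mulLeft (V s.toNNReal)).comp (amplHom h)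

theorem cocycleSum_eq_spectralSum (S : QuantumStopTime k) {t : ℝ≥0}
    (π : TimePartition (t : ℝ≥0∞)) : cocycleSum S V π = spectralSum S (cocycleHom V) π := rfl

theorem TimePartition.coe_toNNReal {t : ℝ≥0} (π : TimePartition (t : ℝ≥0∞)) {s : ℝ≥0∞}
    (hs : s ∈ π.1) : (s.toNNReal : ℝ≥0∞) = s :=
  ENNReal.coe_toNNReal (ne_top_of_le_ne_top ENNReal.coe_ne_top (π.2.2.2 s hs))

theorem ampl_timeProjSum (S : QuantumStopTime k) {t : ℝ≥0∞} (π : TimePartition t)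
    (z : HTensor h (FockSpace k)) :
    ampl h (timeProjSum S π) z = ∑ s ∈ π.1.erase 0,
      ampl h (S.proj (Set.Ioc (π.pred s) s)) (ampl h (timeProj s) z) := by
  have hsum : timeProjSum S π =
      ∑ s ∈ π.1.erase 0, S.proj (Set.Ioc (π.pred s) s) * timeProj s := rfl
  rw [hsum, ampl_sum, _root_.sum_apply]
  exact Finset.sum_congr rfl fun s _ => by rw [ampl_mul, mul_apply_eq_comp]

end CocycleSum

section StoppedCocycle

variable {k : Type*} [NormedAddCommGroup k] [InnerProductSpace ℂ k]
  {h : Type*} [NormedAddCommGroup h] [InnerProductSpace ℂ h] [CompleteSpace h]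
  {𝒜 : VonNeumannAlgebra h} {p : k →L[ℂ] k}
  {V : ℝ≥0 → HTensor h (FockSpace k) →L[ℂ] HTensor h (FockSpace k)}

theorem isStarProjection_ampl_proj (S : QuantumStopTime k) {A : Set ℝ≥0∞} (hA : MeasurableSet A) :
    IsStarProjection (ampl h (S.proj A)) :=
  isStarProjection_ampl (S.isStarProjection A hA)

/-- Since `V_r^* V_s` belongs to the future of `b`, it commutes with `S((a, b])`. -/
theorem IsIsometricCocycle.inner_proj_Ioc (hV : IsIsometricCocycle 𝒜 p V) (S : QuantumStopTime k)
    (hS : S.proj {0} = 0) {a b : ℝ≥0∞} {r s : ℝ≥0} (hab : a ≤ b) (hr : b ≤ r) (hs : b ≤ s)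
    (x y : HTensor h (FockSpace k)) :
    ⟪V r (ampl h (S.proj (Set.Ioc a b)) x), V s y⟫_ℂ =
      ⟪V r (ampl h (S.proj (Set.Ioc a b)) x), V s (ampl h (S.proj (Set.Ioc a b)) y)⟫_ℂ := by
  lift b to ℝ≥0 using ne_top_of_le_ne_top ENNReal.coe_ne_top hr
  lift a to ℝ≥0 using ne_top_of_le_ne_top ENNReal.coe_ne_top hab
  obtain ⟨X, hX⟩ := S.exists_proj_Ioc_eq_tensorAt hS (a := a) (b := b) (by exact_mod_cast hab)
  obtain ⟨Y, hY⟩ := hV.exists_adjoint_comp_eq (b := b) (by exact_mod_cast hr)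
    (by exact_mod_cast hs)
  have hP := isStarProjection_ampl_proj (h := h) S
    (measurableSet_Ioc (a := (a : ℝ≥0∞)) (b := (b : ℝ≥0∞)))
  have hcomm : ampl h (S.proj (Set.Ioc (a : ℝ≥0∞) b)) ∘L
      (ContinuousLinearMap.adjoint (V r) ∘L V s) =
      (ContinuousLinearMap.adjoint (V r) ∘L V s) ∘L ampl h (S.proj (Set.Ioc (a : ℝ≥0∞) b)) := by
    rw [hY, hX, ampl_tensorAt_comm]
  set P := ampl h (S.proj (Set.Ioc (a : ℝ≥0∞) b))
  have hPP : P (P x) = P x := by rw [← mul_apply_eq_comp, hP.isIdempotentElem]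
  have hc : P (ContinuousLinearMap.adjoint (V r) (V s y)) =
      ContinuousLinearMap.adjoint (V r) (V s (P y)) := congrArg (fun T => T y) hcomm
  rw [← ContinuousLinearMap.adjoint_inner_right (V r) (P x) (V s y),
    ← ContinuousLinearMap.adjoint_inner_right (V r) (P x) (V s (P y)), ← hc,
    ← inner_apply_of_isStarProjection hP, hPP]

/-- On a product vector, `V_r - V_s` and `S((a, b])` are independent for `b ≤ r, s`. -/
theorem IsIsometricCocycle.norm_sq_mul_norm_sq_sub (hV : IsIsometricCocycle 𝒜 p V)
    (S : QuantumStopTime k) (hS : S.proj {0} = 0) {a b : ℝ≥0∞} {r s : ℝ≥0} (hab : a ≤ b)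
    (hr : b ≤ r) (hs : b ≤ s) (u : h) (f : L2 k) :
    ‖htmul u (expVec f)‖ ^ 2 *
        ‖V r (ampl h (S.proj (Set.Ioc a b)) (htmul u (expVec f))) -
          V s (ampl h (S.proj (Set.Ioc a b)) (htmul u (expVec f)))‖ ^ 2 =
      ‖ampl h (S.proj (Set.Ioc a b)) (htmul u (expVec f))‖ ^ 2 *
        ‖V r (htmul u (expVec f)) - V s (htmul u (expVec f))‖ ^ 2 := by
  lift b to ℝ≥0 using ne_top_of_le_ne_top ENNReal.coe_ne_top hr
  lift a to ℝ≥0 using ne_top_of_le_ne_top ENNReal.coe_ne_top hab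
  obtain ⟨X, hX⟩ := S.exists_proj_Ioc_eq_tensorAt hS (a := a) (b := b) (by exact_mod_cast hab)
  have key : ∀ r s : ℝ≥0, b ≤ r → b ≤ s →
      (‖htmul u (expVec f)‖ : ℂ) ^ 2 *
        ⟪V r (ampl h (S.proj (Set.Ioc (a : ℝ≥0∞) b)) (htmul u (expVec f))),
          V s (ampl h (S.proj (Set.Ioc (a : ℝ≥0∞) b)) (htmul u (expVec f)))⟫_ℂ =
      (‖ampl h (S.proj (Set.Ioc (a : ℝ≥0∞) b)) (htmul u (expVec f))‖ : ℂ) ^ 2 *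
        ⟪V r (htmul u (expVec f)), V s (htmul u (expVec f))⟫_ℂ := by
    intro r s hr hs
    obtain ⟨Y, hY⟩ := hV.exists_adjoint_comp_eq hr hs
    have hadj : ∀ x y, ⟪V r x, V s y⟫_ℂ = ⟪x, pullOp (splitR b) (opTensor 1 Y) y⟫_ℂ := by
      intro x y
      rw [← hY, ContinuousLinearMap.comp_apply, ContinuousLinearMap.adjoint_inner_right]
    rw [hadj, hadj, hX, norm_sq_mul_inner_pastFuture]
  have hr' : b ≤ r := by exact_mod_cast hr
  have hs' : b ≤ s := by exact_mod_cast hs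
  have h1 := key r r hr' hr'
  have h2 := key r s hr' hs'
  have h3 := key s r hs' hr'
  have h4 := key s s hs' hs'
  have hn : ∀ x : HTensor h (FockSpace k), (‖x‖ : ℂ) ^ 2 = ⟪x, x⟫_ℂ := fun x =>
    (inner_self_eq_norm_sq_to_K x).symm
  generalize htmul u (expVec f) = z at h1 h2 h3 h4 ⊢
  generalize ampl h (S.proj (Set.Ioc (a : ℝ≥0∞) b)) z = w at h1 h2 h3 h4 ⊢
  have hC : (‖z‖ : ℂ) ^ 2 * (‖V r w - V s w‖ : ℂ) ^ 2 =
      (‖w‖ : ℂ) ^ 2 * (‖V r z - V s z‖ : ℂ) ^ 2 := by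
    rw [hn (V r w - V s w), hn (V r z - V s z)]
    simp only [inner_sub_left, inner_sub_right]
    linear_combination h1 - h2 - h3 + h4
  exact_mod_cast hC

/-- The vectors `V_r S((π_{i-1}, π_i]) x` and `V_{r'} S((π_{j-1}, π_j]) y` are orthogonal for
`i ≠ j`, `π_i ≤ r` and `π_j ≤ r'`. -/
theorem IsIsometricCocycle.inner_eq_zero_of_ne (hV : IsIsometricCocycle 𝒜 p V)
    (S : QuantumStopTime k) (hS : S.proj {0} = 0) {t : ℝ≥0∞} (π : TimePartition t)
    {s s' : ℝ≥0∞} (hs : s ∈ π.1.erase 0) (hs' : s' ∈ π.1.erase 0) (hne : s ≠ s') {r r' : ℝ≥0}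
    (hr : s ≤ r) (hr' : s' ≤ r') (x y : HTensor h (FockSpace k)) :
    ⟪V r (ampl h (S.proj (Set.Ioc (π.pred s) s)) x),
      V r' (ampl h (S.proj (Set.Ioc (π.pred s') s')) y)⟫_ℂ = 0 := by
  wlog hlt : s < s' generalizing s s' r r' x y
  · rw [← inner_conj_symm, this hs' hs hne.symm hr' hr y x
      (lt_of_le_of_ne (not_lt.1 hlt) hne.symm), map_zero]
  rw [hV.inner_proj_Ioc S hS (π.pred_le hs) hr (hlt.le.trans hr'), ← mul_apply_eq_comp (ampl h _),
    ← ampl_mul, π.proj_mul_proj S hs hs' hne, ampl_zero]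
  simp

theorem TimePartition.sum_norm_sq_proj (S : QuantumStopTime k) {t : ℝ≥0∞}
    (π : TimePartition t) (z : HTensor h (FockSpace k)) :
    ∑ s ∈ π.1.erase 0, ‖ampl h (S.proj (Set.Ioc (π.pred s) s)) z‖ ^ 2 =
      ‖ampl h (S.proj (Set.Ioc 0 t)) z‖ ^ 2 := by
  rw [← sum_proj_Ioc_pred S π, ampl_sum, _root_.sum_apply, norm_sq_sum_of_orthogonal]
  intro s hs s' hs' hne
  rw [inner_apply_of_isStarProjection (isStarProjection_ampl_proj S measurableSet_Ioc),
    ← mul_apply_eq_comp (ampl h _), ← ampl_mul, π.proj_mul_proj S hs hs' hne, ampl_zero]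
  simp

theorem TimePartition.sum_norm_sq_proj_le (S : QuantumStopTime k) {t : ℝ≥0∞}
    (π : TimePartition t) (z : HTensor h (FockSpace k)) :
    ∑ s ∈ π.1.erase 0, ‖ampl h (S.proj (Set.Ioc (π.pred s) s)) z‖ ^ 2 ≤ ‖z‖ ^ 2 := by
  rw [π.sum_norm_sq_proj]
  exact pow_le_pow_left₀ (norm_nonneg _) (norm_apply_le_of_isStarProjection
    (isStarProjection_ampl_proj S measurableSet_Ioc) z) 2

theorem IsIsometricCocycle.norm_sq_cocycleSum (hV : IsIsometricCocycle 𝒜 p V)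
    (S : QuantumStopTime k) (hS : S.proj {0} = 0) {t : ℝ≥0} (π : TimePartition (t : ℝ≥0∞))
    (z : HTensor h (FockSpace k)) :
    ‖cocycleSum S V π z‖ ^ 2 =
      ∑ s ∈ π.1.erase 0, ‖V s.toNNReal (ampl h (S.proj (Set.Ioc (π.pred s) s)) z)‖ ^ 2 := by
  rw [cocycleSum, _root_.sum_apply, norm_sq_sum_of_orthogonal]
  · rfl
  · intro s hs s' hs' hne
    exact hV.inner_eq_zero_of_ne S hS π hs hs' hne
      (π.coe_toNNReal (Finset.mem_of_mem_erase hs)).ge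
      (π.coe_toNNReal (Finset.mem_of_mem_erase hs')).ge z z

theorem IsIsometricCocycle.norm_cocycleSum_le (hV : IsIsometricCocycle 𝒜 p V)
    (S : QuantumStopTime k) (hS : S.proj {0} = 0) {t : ℝ≥0} (π : TimePartition (t : ℝ≥0∞))
    (z : HTensor h (FockSpace k)) : ‖cocycleSum S V π z‖ ≤ ‖z‖ := by
  refine le_of_pow_le_pow_left₀ two_ne_zero (norm_nonneg _) ?_
  rw [hV.norm_sq_cocycleSum S hS]
  exact (Finset.sum_le_sum fun s _ => pow_le_pow_left₀ (norm_nonneg _)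
    (hV.norm_apply_le _ _) 2).trans (π.sum_norm_sq_proj_le S z)

/-- The difference of two sums is a sum of mutually orthogonal vectors, over the finer partition. -/
theorem IsIsometricCocycle.norm_sq_cocycleSum_sub (hV : IsIsometricCocycle 𝒜 p V)
    (S : QuantumStopTime k) (hS : S.proj {0} = 0) {t : ℝ≥0} {π π' : TimePartition (t : ℝ≥0∞)}
    (hle : π ≤ π') (z : HTensor h (FockSpace k)) :
    ‖cocycleSum S V π' z - cocycleSum S V π z‖ ^ 2 =
      ∑ s ∈ π'.1.erase 0, ‖V s.toNNReal (ampl h (S.proj (Set.Ioc (π'.pred s) s)) z) -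
        V (π.next s).toNNReal (ampl h (S.proj (Set.Ioc (π'.pred s) s)) z)‖ ^ 2 := by
  rw [cocycleSum_eq_spectralSum S π, spectralSum_eq_of_le S _ hle, cocycleSum, _root_.sum_apply,
    _root_.sum_apply, ← Finset.sum_sub_distrib, norm_sq_sum_of_orthogonal]
  · rfl
  · intro s hs s' hs' hne
    change ⟪V _ (ampl h _ z) - V _ (ampl h _ z), V _ (ampl h _ z) - V _ (ampl h _ z)⟫_ℂ = 0
    have hn : ∀ s ∈ π'.1.erase 0, s ≤ ((π.next s).toNNReal : ℝ≥0∞) := fun s hs => by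
      rw [π.coe_toNNReal (π.next_mem (π'.2.2.2 s (Finset.mem_of_mem_erase hs)))]
      exact π.le_next s
    have hc : ∀ s ∈ π'.1.erase 0, s ≤ (s.toNNReal : ℝ≥0∞) := fun s hs =>
      (π'.coe_toNNReal (Finset.mem_of_mem_erase hs)).ge
    rw [inner_sub_left, inner_sub_right, inner_sub_right,
      hV.inner_eq_zero_of_ne S hS π' hs hs' hne (hc s hs) (hc s' hs'),
      hV.inner_eq_zero_of_ne S hS π' hs hs' hne (hc s hs) (hn s' hs'),
      hV.inner_eq_zero_of_ne S hS π' hs hs' hne (hn s hs) (hc s' hs'),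
      hV.inner_eq_zero_of_ne S hS π' hs hs' hne (hn s hs) (hn s' hs')]
    simp

/-- For a product vector `z`, the square of the distance between two sums is an average of
`‖V_s z - V_{s'} z‖²` with `s'` the next point of the coarser partition, so uniform continuity on
`[0, t]` makes the sums a Cauchy net. -/
theorem IsIsometricCocycle.cauchySeq_cocycleSum (hV : IsIsometricCocycle 𝒜 p V)
    (hcont : ∀ z, Continuous fun t => V t z) (S : QuantumStopTime k) (hS : S.proj {0} = 0)
    (t : ℝ≥0) (u : h) (f : L2 k) :
    CauchySeq fun π : TimePartition (t : ℝ≥0∞) => cocycleSum S V π (htmul u (expVec f)) := by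
  -- The independence identity carries a factor `‖z‖²`, which can be cancelled only if `z ≠ 0`.
  rcases eq_or_ne (htmul u (expVec f)) 0 with h0 | h0
  · simpa [h0] using cauchySeq_const (0 : HTensor h (FockSpace k))
  refine Metric.cauchySeq_iff'.2 fun ε hε => ?_
  have huc := Metric.uniformContinuousOn_iff.1
    ((isCompact_Icc (a := (0 : ℝ≥0)) (b := t)).uniformContinuousOn_of_continuous
      (hcont (htmul u (expVec f))).continuousOn) (ε / 2) (half_pos hε)
  obtain ⟨δ, hδ, hδ'⟩ := huc
  lift δ to ℝ≥0 using hδ.le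
  obtain ⟨π, hπ⟩ := TimePartition.exists_mesh_le t (δ := δ / 2)
    (half_pos (by exact_mod_cast hδ))
  refine ⟨π, fun π' hle => ?_⟩
  rw [dist_eq_norm]
  have hle' : ‖cocycleSum S V π' (htmul u (expVec f)) - cocycleSum S V π (htmul u (expVec f))‖ ≤
      ε / 2 := by
    refine le_of_pow_le_pow_left₀ two_ne_zero (half_pos hε).le ?_
    refine le_of_mul_le_mul_left ?_ (pow_pos (norm_pos_iff.2 h0) 2)
    rw [hV.norm_sq_cocycleSum_sub S hS hle, Finset.mul_sum]
    calc _ ≤ ∑ s ∈ π'.1.erase 0,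
          ‖ampl h (S.proj (Set.Ioc (π'.pred s) s)) (htmul u (expVec f))‖ ^ 2 * (ε / 2) ^ 2 := by
          refine Finset.sum_le_sum fun s hs => ?_
          have hs' := Finset.mem_of_mem_erase hs
          have hst := π'.2.2.2 s hs'
          have hn := π.next_mem hst
          have e1 := π'.coe_toNNReal hs'
          have e2 := π.coe_toNNReal hn
          have h1 : s ≤ π.next s := π.le_next s
          rw [hV.norm_sq_mul_norm_sq_sub S hS (π'.pred_le hs) e1.ge (e2.symm ▸ h1)]
          refine mul_le_mul_of_nonneg_left (pow_le_pow_left₀ (norm_nonneg _) ?_ 2) (by positivity)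
          have hst' : s.toNNReal ≤ t := by
            rw [← e1] at hst
            exact_mod_cast hst
          have hnt : (π.next s).toNNReal ≤ t := by
            have := π.2.2.2 _ hn
            rw [← e2] at this
            exact_mod_cast this
          have h2 : s.toNNReal ≤ (π.next s).toNNReal := by
            rw [← ENNReal.coe_le_coe, e1, e2]
            exact h1
          have h3 : (π.next s).toNNReal ≤ s.toNNReal + δ / 2 := by
            have := hπ _ hst'
            rw [e1, ← e2] at this
            rw [← ENNReal.coe_le_coe, ENNReal.coe_add, e1]
            exact this
          rw [← dist_eq_norm]
          refine (hδ' _ ⟨zero_le, hst'⟩ _ ⟨zero_le, hnt⟩ ?_).le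
          rw [dist_comm, NNReal.dist_eq, abs_of_nonneg (sub_nonneg.2 (by exact_mod_cast h2))]
          have h4 : ((π.next s).toNNReal : ℝ) ≤ s.toNNReal + δ / 2 := by exact_mod_cast h3
          linarith
      _ ≤ _ := by
          rw [← Finset.sum_mul]
          exact mul_le_mul_of_nonneg_right (π'.sum_norm_sq_proj_le S _) (by positivity)
  linarith

theorem IsIsometricCocycle.hasStrongLim_cocycleSum (hV : IsIsometricCocycle 𝒜 p V)
    (hcont : ∀ z, Continuous fun t => V t z) (S : QuantumStopTime k) (hS : S.proj {0} = 0)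
    (t : ℝ≥0) :
    HasStrongLim atTop (fun π : TimePartition (t : ℝ≥0∞) => cocycleSum S V π)
      (stoppedCocycle S V t) :=
  .strongLim (exists_hasStrongLim_of_total (fun π : TimePartition (t : ℝ≥0∞) => cocycleSum S V π)
    (fun π => hV.norm_cocycleSum_le S hS π) span_htmul_expVec_dense
    fun uf : h × L2 k => hV.cauchySeq_cocycleSum hcont S hS t uf.1 uf.2)

theorem IsIsometricCocycle.norm_stoppedCocycle_le (hV : IsIsometricCocycle 𝒜 p V)
    (hcont : ∀ z, Continuous fun t => V t z) (S : QuantumStopTime k) (hS : S.proj {0} = 0)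
    (t : ℝ≥0) (z : HTensor h (FockSpace k)) : ‖stoppedCocycle S V t z‖ ≤ ‖z‖ :=
  le_of_tendsto (hV.hasStrongLim_cocycleSum hcont S hS t z).norm
    (Eventually.of_forall fun π => hV.norm_cocycleSum_le S hS π z)

/-- `V_{S,t} S([0, r]) = V_{S,r}` for `r ≤ t`, which reduces the existence of `V_S` to the convergence
of `S([0, r])`. -/
theorem IsIsometricCocycle.stoppedCocycle_comp_proj_Icc (hV : IsIsometricCocycle 𝒜 p V)
    (hcont : ∀ z, Continuous fun t => V t z) (S : QuantumStopTime k) (hS : S.proj {0} = 0)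
    {r t : ℝ≥0} (hr : r ≤ t) :
    stoppedCocycle S V t ∘L ampl h (S.proj (Set.Icc 0 (r : ℝ≥0∞))) = stoppedCocycle S V r := by
  have hr' : (r : ℝ≥0∞) ≤ t := by exact_mod_cast hr
  refine HasStrongLim.unique (l := atTop) (T := fun π : TimePartition (t : ℝ≥0∞) =>
    cocycleSum S V (π.restrict r)) (fun z => ?_)
    fun z => (hV.hasStrongLim_cocycleSum hcont S hS r z).comp (TimePartition.tendsto_restrict hr')
  refine (hV.hasStrongLim_cocycleSum hcont S hS t
    (ampl h (S.proj (Set.Icc 0 (r : ℝ≥0∞))) z)).congr' ?_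
  filter_upwards [TimePartition.eventually_mem hr'] with π hπ
  rw [cocycleSum_eq_spectralSum, cocycleSum_eq_spectralSum, spectralSum_restrict S _ hπ,
    spectralSum, _root_.sum_apply, _root_.sum_apply]
  refine Finset.sum_congr rfl fun s _ => ?_
  rw [S.proj_mul_proj measurableSet_Icc measurableSet_Ioc, Set.inter_comm,
    ← S.proj_mul_proj measurableSet_Ioc measurableSet_Icc]
  change _ = V s.toNNReal (ampl h (_ * _) z)
  rw [ampl_mul]
  rfl

theorem hasStrongLim_ampl_proj_Icc (S : QuantumStopTime k) (hS : S.proj {⊤} = 0) :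
    HasStrongLim atTop (fun r : ℝ≥0 => ampl h (S.proj (Set.Icc 0 (r : ℝ≥0∞)))) 1 := by
  rw [← ampl_one]
  exact hasStrongLim_ampl (fun r => S.isStarProjection _ measurableSet_Icc)
    (hasStrongLim_proj_Icc S hS)

theorem IsIsometricCocycle.hasStrongLim_stoppedCocycle (hV : IsIsometricCocycle 𝒜 p V)
    (hcont : ∀ z, Continuous fun t => V t z) (S : QuantumStopTime k) (hS : S.proj {0} = 0)
    (hfin : S.proj {⊤} = 0) :
    HasStrongLim atTop (fun r : ℝ≥0 => stoppedCocycle S V r) (stoppedCocycle S V ⊤) := by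
  refine .strongLim (exists_hasStrongLim_of_cauchySeq _
    (fun r => hV.norm_stoppedCocycle_le hcont S hS r) fun z =>
    Metric.cauchySeq_iff'.2 fun ε hε => ?_)
  obtain ⟨N, hN⟩ := (Metric.tendsto_atTop.1 (hasStrongLim_ampl_proj_Icc S hfin z)) ε hε
  refine ⟨N, fun n hn => ?_⟩
  have h1 := hN N le_rfl
  rw [← hV.stoppedCocycle_comp_proj_Icc hcont S hS hn, dist_eq_norm, ContinuousLinearMap.comp_apply,
    ← map_sub]
  refine (hV.norm_stoppedCocycle_le hcont S hS n _).trans_lt ?_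
  rwa [dist_comm, dist_eq_norm, one_apply_eq_self] at h1

/-! ### Vacuum adapted cocycles -/

/-- Letting first `π'` and then `π` tend to the limit in `E_{S,π'} E_{S,π} = E_{S,π'}` for `π ≤ π'` shows
that `E_{S,t}` is idempotent. -/
theorem stoppedTimeProj_mul_self (S : QuantumStopTime k) (hS : S.proj {0} = 0) (t : ℝ≥0∞) :
    stoppedTimeProj S t * stoppedTimeProj S t = stoppedTimeProj S t := by
  have hlim := hasStrongLim_timeProjSum S hS t
  have h1 : ∀ π : TimePartition t, stoppedTimeProj S t * timeProjSum S π = stoppedTimeProj S t := by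
    refine fun π => HasStrongLim.unique (l := atTop) (T := fun π' : TimePartition t =>
      timeProjSum S π') (fun z => ?_) hlim
    refine (hlim (timeProjSum S π z)).congr' ?_
    filter_upwards [eventually_ge_atTop π] with π' hπ'
    rw [← mul_apply_eq_comp, timeProjSum_mul_of_le S hS hπ']
  ext z
  refine tendsto_nhds_unique (((stoppedTimeProj S t).continuous.tendsto _).comp (hlim z)) ?_
  refine tendsto_const_nhds.congr fun π => ?_
  exact (congrArg (fun T => T z) (h1 π)).symm

theorem IsIsometricCocycle.norm_cocycleSum_of_vacuum (hV : IsIsometricCocycle 𝒜 0 V)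
    (S : QuantumStopTime k) (hS : S.proj {0} = 0) {t : ℝ≥0} (π : TimePartition (t : ℝ≥0∞))
    (z : HTensor h (FockSpace k)) :
    ‖cocycleSum S V π z‖ = ‖ampl h (timeProjSum S π) z‖ := by
  refine (pow_left_inj₀ (norm_nonneg _) (norm_nonneg _) two_ne_zero).1 ?_
  rw [hV.norm_sq_cocycleSum S hS, ampl_timeProjSum, norm_sq_sum_of_orthogonal]
  · refine Finset.sum_congr rfl fun s hs => ?_
    rw [hV.norm_sq_apply, hV.adjoint_comp_self, tensorAtL_futureProj_zero,
      π.coe_toNNReal (Finset.mem_of_mem_erase hs), ← mul_apply_eq_comp, ← ampl_mul,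
      ← S.proj_Ioc_timeProj_comm hS (π.pred_le hs), ampl_mul, mul_apply_eq_comp]
  · intro s hs s' hs' hne
    rw [inner_apply_of_isStarProjection (isStarProjection_ampl_proj S measurableSet_Ioc),
      ← mul_apply_eq_comp (ampl h _), ← ampl_mul, π.proj_mul_proj S hs hs' hne, ampl_zero]
    simp

theorem IsIsometricCocycle.norm_stoppedCocycle_of_vacuum (hV : IsIsometricCocycle 𝒜 0 V)
    (hcont : ∀ z, Continuous fun t => V t z) (S : QuantumStopTime k) (hS : S.proj {0} = 0)
    (hfin : S.proj {⊤} = 0) (t : ℝ≥0∞) (z : HTensor h (FockSpace k)) :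
    ‖stoppedCocycle S V t z‖ = ‖ampl h (stoppedTimeProj S t) z‖ := by
  have hlt : ∀ t : ℝ≥0, ‖stoppedCocycle S V t z‖ = ‖ampl h (stoppedTimeProj S t) z‖ := fun t =>
    tendsto_nhds_unique (hV.hasStrongLim_cocycleSum hcont S hS t z).norm
      (((hasStrongLim_ampl (isStarProjection_timeProjSum S hS)
        (hasStrongLim_timeProjSum S hS t)) z).norm.congr fun π =>
          (hV.norm_cocycleSum_of_vacuum S hS π z).symm)
  rcases eq_or_ne t ⊤ with rfl | ht
  · refine tendsto_nhds_unique (hV.hasStrongLim_stoppedCocycle hcont S hS hfin z).norm ?_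
    refine (hasStrongLim_ampl_proj_Icc S hfin (ampl h (stoppedTimeProj S ⊤) z)).norm.congr
      fun r => ?_
    rw [hlt, ← mul_apply_eq_comp, ← ampl_mul, proj_Icc_mul_stoppedTimeProj S hS le_top]
  · lift t to ℝ≥0 using ht
    exact hlt t

/-- As `‖V_{S,t} z‖ = ‖E_{S,t} z‖` and `E_{S,t}` is idempotent, `V_{S,t}` kills the range of
`1 - E_{S,t}`. -/
theorem IsIsometricCocycle.stoppedCocycle_comp_stoppedTimeProj (hV : IsIsometricCocycle 𝒜 0 V)
    (hcont : ∀ z, Continuous fun t => V t z) (S : QuantumStopTime k) (hS : S.proj {0} = 0)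
    (hfin : S.proj {⊤} = 0) (t : ℝ≥0∞) :
    stoppedCocycle S V t ∘L ampl h (stoppedTimeProj S t) = stoppedCocycle S V t := by
  ext z
  rw [ContinuousLinearMap.comp_apply, ← sub_eq_zero, ← map_sub, ← norm_eq_zero,
    hV.norm_stoppedCocycle_of_vacuum hcont S hS hfin, map_sub, ← mul_apply_eq_comp, ← ampl_mul,
    stoppedTimeProj_mul_self S hS, sub_self, norm_zero]

/-! ### Identity adapted cocycles -/

theorem IsIsometricCocycle.norm_cocycleSum_of_identity (hV : IsIsometricCocycle 𝒜 1 V)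
    (S : QuantumStopTime k) (hS : S.proj {0} = 0) {t : ℝ≥0} (π : TimePartition (t : ℝ≥0∞))
    (z : HTensor h (FockSpace k)) :
    ‖cocycleSum S V π z‖ = ‖ampl h (S.proj (Set.Icc 0 (t : ℝ≥0∞))) z‖ := by
  refine (pow_left_inj₀ (norm_nonneg _) (norm_nonneg _) two_ne_zero).1 ?_
  rw [hV.norm_sq_cocycleSum S hS, ← S.proj_Ioc_zero hS, ← π.sum_norm_sq_proj S]
  refine Finset.sum_congr rfl fun s _ => ?_
  rw [hV.norm_sq_apply, hV.adjoint_comp_self, futureProj_one, tensorAtL_one_one,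
    one_apply_eq_self]

theorem IsIsometricCocycle.norm_stoppedCocycle_of_identity (hV : IsIsometricCocycle 𝒜 1 V)
    (hcont : ∀ z, Continuous fun t => V t z) (S : QuantumStopTime k) (hS : S.proj {0} = 0)
    (hfin : S.proj {⊤} = 0) (t : ℝ≥0∞) (z : HTensor h (FockSpace k)) :
    ‖stoppedCocycle S V t z‖ = ‖ampl h (S.proj (Set.Icc 0 t)) z‖ := by
  have hlt : ∀ t : ℝ≥0, ‖stoppedCocycle S V t z‖ =
      ‖ampl h (S.proj (Set.Icc 0 (t : ℝ≥0∞))) z‖ := fun t =>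
    tendsto_nhds_unique (hV.hasStrongLim_cocycleSum hcont S hS t z).norm
      (tendsto_const_nhds.congr fun π => (hV.norm_cocycleSum_of_identity S hS π z).symm)
  rcases eq_or_ne t ⊤ with rfl | ht
  · refine tendsto_nhds_unique (hV.hasStrongLim_stoppedCocycle hcont S hS hfin z).norm ?_
    have huniv : Set.Icc 0 ⊤ = (Set.univ : Set ℝ≥0∞) := Set.Icc_bot_top
    rw [huniv, S.proj_univ, ampl_one]
    exact (hasStrongLim_ampl_proj_Icc S hfin z).norm.congr fun r => (hlt r).symm
  · lift t to ℝ≥0 using ht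
    exact hlt t

end StoppedCocycle

end StopCCR

theorem mainTheorem9
    {k : Type*} [NormedAddCommGroup k] [InnerProductSpace ℂ k] [CompleteSpace k]
    {h : Type*} [NormedAddCommGroup h] [InnerProductSpace ℂ h] [CompleteSpace h]
    (𝒜 : VonNeumannAlgebra h)
    (S : QuantumStopTime k) (hS_zero : S.proj {0} = 0) (hS_fin : S.proj {⊤} = 0)
    (V : ℝ≥0 → HTensor h (FockSpace k) →L[ℂ] HTensor h (FockSpace k))
    (hV_cont : ∀ z, Continuous fun t => V t z) :
    (IsIsometricCocycle 𝒜 0 V →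
      (∀ t : ℝ≥0∞, 0 < t → HasStrongLim atTop (fun π : TimePartition t => timeProjSum S π)
        (stoppedTimeProj S t)) ∧
      (∀ t : ℝ≥0, 0 < t → HasStrongLim atTop (fun π : TimePartition (t : ℝ≥0∞) => cocycleSum S V π)
        (stoppedCocycle S V t)) ∧
      HasStrongLim atTop (fun r : ℝ≥0 => stoppedCocycle S V r) (stoppedCocycle S V ⊤) ∧
      ∀ t : ℝ≥0∞, 0 < t →
        stoppedCocycle S V t ∘L ampl h (stoppedTimeProj S t) = stoppedCocycle S V t ∧
        ∀ z, ‖stoppedCocycle S V t z‖ = ‖ampl h (stoppedTimeProj S t) z‖) ∧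
    (IsIsometricCocycle 𝒜 1 V →
      (∀ t : ℝ≥0, 0 < t → HasStrongLim atTop (fun π : TimePartition (t : ℝ≥0∞) => cocycleSum S V π)
        (stoppedCocycle S V t)) ∧
      HasStrongLim atTop (fun r : ℝ≥0 => stoppedCocycle S V r) (stoppedCocycle S V ⊤) ∧
      (∀ t : ℝ≥0∞, 0 < t →
        ∀ z, ‖stoppedCocycle S V t z‖ = ‖ampl h (S.proj (Set.Icc 0 t)) z‖) ∧
      ∀ z, ‖stoppedCocycle S V ⊤ z‖ = ‖z‖) := by
  refine ⟨fun hV => ⟨fun t _ => hasStrongLim_timeProjSum S hS_zero t,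
    fun t _ => hV.hasStrongLim_cocycleSum hV_cont S hS_zero t,
    hV.hasStrongLim_stoppedCocycle hV_cont S hS_zero hS_fin, fun t _ =>
    ⟨hV.stoppedCocycle_comp_stoppedTimeProj hV_cont S hS_zero hS_fin t,
      hV.norm_stoppedCocycle_of_vacuum hV_cont S hS_zero hS_fin t⟩⟩,
    fun hV => ⟨fun t _ => hV.hasStrongLim_cocycleSum hV_cont S hS_zero t,
    hV.hasStrongLim_stoppedCocycle hV_cont S hS_zero hS_fin, fun t _ =>
    hV.norm_stoppedCocycle_of_identity hV_cont S hS_zero hS_fin t, fun z => ?_⟩⟩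
  have huniv : Set.Icc 0 ⊤ = (Set.univ : Set ℝ≥0∞) := Set.Icc_bot_top
  rw [hV.norm_stoppedCocycle_of_identity hV_cont S hS_zero hS_fin, huniv, S.proj_univ, ampl_one,
    one_apply_eq_self]
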